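/- Let $0<\alpha<1$ and $0<\beta<1$ with $1-\alpha-\beta>0$. Functions on $[0,1]$ are real or complex valued. For such a function $g$ and $\delta>0$ put $$\omega_\beta(g,\delta)=\sup_{s,t\in[0,1],\ 0<|s-t|\le\delta}\frac{|g(t)-g(s)|}{|t-s|^\beta}.$$ Let $H^\beta$ be the Banach space of $\beta$-Hölder functions $g$ on $[0,1]$ with $g(0)=0$ and norm $\|g\|_\beta=\omega_\beta(g,1)$. Let $H^\beta_0=\{g\in H^\beta:\lim_{\delta\to0}\omega_\beta(g,\delta)=0\}$ and $X_\beta=\{f\in H^\beta: f'\in H_0^\beta\}$. Let $A=\frac{d}{dx}$ on $H^\beta$ with domain $D(A)=\{f\in H^\beta: f'\in H^\beta\}$. For $h=1/n$ with an integer $n\ge1$, let $t_k=kh$ ($0\le k\le n$), let $\nabla_hf(x)=\frac{f(x)-f(x-h)}{h}$ for $h\le x\le 1$ and $\nabla_hf(x)=\frac{f(x)}h$ for $0\le x<h$, and let $A_hf$ be the continuous function on $[0,1]$ that is affine on each $[t_{k-1},t_k]$ and equals $\nabla_hf$ at every $t_k$; this defines a linear operator $A_h$ on $H^\beta$ (the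 extended nabla operator). For an operator $B$ on $H^\beta$ (here $B=A$ or $B=A_h$) and $f\in D(B)$ the fractional power is defined by the Balakrishnan integral $$B^\alpha f=\frac{\sin\alpha\pi}{\pi}\int_0^\infty\lambda^{\alpha-1}(\lambda+B)^{-1}Bf\,d\lambda .$$ **Theorem.** Let $f\in X_\beta$. For $B=A$ and for every $B=A_h$, $h=1/n$, $n\ge1$, the operator $\lambda+B$ is a bijection from $D(B)$ onto $H^\beta$ with bounded inverse for every $\lambda>0$, and the integral defining $B^\alpha f$ converges as a Bochner integral in $H^\beta$. As $h=1/n\to0$, $$\|A^\alpha f-A_h^\alpha f\|_\beta\to0,$$ that is, $A_h^\alpha\to A^\alpha$ strongly on $X_\beta$. Moreover, for every $h=1/n$, $n\ge1$, $$\|A^\alpha f-A_h^\alpha f\|_\beta\le 2\Big(\frac{16}{\Gamma(2-\alpha)}+\frac{C}{\Gamma(1-\alpha)}+1\Big)\|f'\|_\beta\,h^{1-\alpha-\beta}+\frac{2^{\beta+1}+6}{\Gamma(2-\alpha)}\,\omega_\beta(f',2h),$$ where $C=\frac1{1-\alpha}-\Gamma(2-\alpha)+1+\frac\alpha2\,\zeta(1+\alpha)$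 and $\zeta$ is the Riemann zeta function. -/

import Mathlib

open Set Filter Topology MeasureTheory

noncomputable section

namespace FracNabla

/-! ### Hölder spaces on `[0,1]` -/

/-- The Hölder modulus
`ω_β(f, δ) = sup { |f t - f s| / |t - s|^β : s, t ∈ [0,1], 0 < |s - t| ≤ δ }`. -/
def modulus {𝕜 : Type*} [RCLike 𝕜] (β : ℝ) (f : unitInterval → 𝕜) (δ : ℝ) : ℝ :=
  sSup {r : ℝ | ∃ s t : unitInterval, 0 < |(s : ℝ) - t| ∧ |(s : ℝ) - t| ≤ δ ∧
    r = ‖f t - f s‖ / |(t : ℝ) - s| ^ β}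

/-- The functions `f : [0,1] → 𝕜` that are Hölder continuous with exponent `β` and satisfy
`f 0 = 0`, as a linear subspace of all functions. -/
def holderSubmodule (β : ℝ) (𝕜 : Type*) [RCLike 𝕜] : Submodule ℝ (unitInterval → 𝕜) where
  carrier := {f | f 0 = 0 ∧
    ∃ C : ℝ, ∀ s t : unitInterval, ‖f t - f s‖ ≤ C * |(t : ℝ) - s| ^ β}
  zero_mem' := ⟨rfl, 0, fun s t => by simp⟩
  add_mem' := by
    rintro f g ⟨hf, C, hC⟩ ⟨hg, D, hD⟩
    refine ⟨by simp [hf, hg], C + D, fun s t => ?_⟩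
    calc ‖(f + g) t - (f + g) s‖ = ‖(f t - f s) + (g t - g s)‖ := by
          congr 1; simp only [Pi.add_apply]; ring
      _ ≤ ‖f t - f s‖ + ‖g t - g s‖ := norm_add_le _ _
      _ ≤ (C + D) * |(t : ℝ) - s| ^ β := by linarith [hC s t, hD s t]
  smul_mem' := by
    rintro c f ⟨hf, C, hC⟩
    refine ⟨by simp [hf], |c| * C, fun s t => ?_⟩
    calc ‖(c • f) t - (c • f) s‖ = |c| * ‖f t - f s‖ := by
          rw [Pi.smul_apply, Pi.smul_apply, ← smul_sub, norm_smul, Real.norm_eq_abs]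
      _ ≤ |c| * (C * |(t : ℝ) - s| ^ β) := by gcongr; exact hC s t
      _ = |c| * C * |(t : ℝ) - s| ^ β := by ring

/-- The Hölder space `H^β`; its norm, defined below, is `ω_β(f, 1)`. -/
def Holder (β : ℝ) (𝕜 : Type*) [RCLike 𝕜] : Type _ := ↥(holderSubmodule β 𝕜)

variable {𝕜 : Type*} [RCLike 𝕜] {β : ℝ}

instance : AddCommGroup (Holder β 𝕜) := inferInstanceAs (AddCommGroup ↥(holderSubmodule β 𝕜))

instance : Module ℝ (Holder β 𝕜) := inferInstanceAs (Module ℝ ↥(holderSubmodule β 𝕜))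

instance : CoeFun (Holder β 𝕜) (fun _ => unitInterval → 𝕜) := ⟨fun f => f.1⟩

instance : Norm (Holder β 𝕜) := ⟨fun f => modulus β f 1⟩

theorem Holder.norm_def (f : Holder β 𝕜) : ‖f‖ = modulus β f 1 := rfl

@[ext] theorem Holder.ext {f g : Holder β 𝕜} (h : ∀ x, f x = g x) : f = g :=
  Subtype.ext (funext h)

@[simp] theorem Holder.add_apply (f g : Holder β 𝕜) (x : unitInterval) :
    (f + g) x = f x + g x := rfl

@[simp] theorem Holder.sub_apply (f g : Holder β 𝕜) (x : unitInterval) :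
    (f - g) x = f x - g x := rfl

@[simp] theorem Holder.smul_apply (c : ℝ) (f : Holder β 𝕜) (x : unitInterval) :
    (c • f) x = c • f x := rfl

@[simp] theorem Holder.zero_apply (x : unitInterval) : (0 : Holder β 𝕜) x = 0 := rfl

theorem Holder.map_zero (f : Holder β 𝕜) : f 0 = 0 := f.2.1

theorem modulus_nonneg (f : unitInterval → 𝕜) (δ : ℝ) : 0 ≤ modulus β f δ := by
  refine Real.sSup_nonneg ?_
  rintro r ⟨s, t, -, -, rfl⟩
  positivity

theorem modulus_le {f : unitInterval → 𝕜} {δ C : ℝ} (hC : 0 ≤ C)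
    (h : ∀ s t : unitInterval, ‖f t - f s‖ ≤ C * |(t : ℝ) - s| ^ β) : modulus β f δ ≤ C := by
  refine Real.sSup_le ?_ hC
  rintro r ⟨s, t, hst, -, rfl⟩
  rw [abs_sub_comm] at hst
  rw [div_le_iff₀ (Real.rpow_pos_of_pos hst β)]
  exact h s t

theorem Holder.norm_sub_apply_le (f : Holder β 𝕜) (s t : unitInterval) :
    ‖f t - f s‖ ≤ ‖f‖ * |(t : ℝ) - s| ^ β := by
  rcases eq_or_ne s t with rfl | hst
  · simp only [sub_self, norm_zero]
    exact mul_nonneg (modulus_nonneg _ _) (by positivity)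
  have hpos : 0 < |(t : ℝ) - s| :=
    abs_pos.2 (sub_ne_zero.2 fun h => hst (Subtype.ext h.symm))
  rw [← div_le_iff₀ (Real.rpow_pos_of_pos hpos β)]
  obtain ⟨C, hC⟩ := f.2.2
  refine le_csSup ⟨C, ?_⟩ ⟨s, t, by rwa [abs_sub_comm], ?_, rfl⟩
  · rintro r ⟨a, b, hab, -, rfl⟩
    rw [abs_sub_comm] at hab
    rw [div_le_iff₀ (Real.rpow_pos_of_pos hab β)]
    exact hC a b
  · rw [abs_le]
    constructor <;> linarith [s.2.1, s.2.2, t.2.1, t.2.2]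

theorem Holder.norm_le {f : Holder β 𝕜} {C : ℝ} (hC : 0 ≤ C)
    (h : ∀ s t : unitInterval, ‖f t - f s‖ ≤ C * |(t : ℝ) - s| ^ β) : ‖f‖ ≤ C :=
  modulus_le hC h

theorem Holder.core : NormedSpace.Core ℝ (Holder β 𝕜) where
  norm_nonneg f := modulus_nonneg _ _
  norm_smul c f := by
    have key : ∀ (c : ℝ) (f : Holder β 𝕜), ‖c • f‖ ≤ ‖c‖ * ‖f‖ := fun c f => by
      refine Holder.norm_le (mul_nonneg (norm_nonneg c) (modulus_nonneg _ _)) fun s t => ?_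
      rw [Holder.smul_apply, Holder.smul_apply, ← smul_sub, norm_smul, mul_assoc]
      exact mul_le_mul_of_nonneg_left (f.norm_sub_apply_le s t) (norm_nonneg c)
    refine le_antisymm (key c f) ?_
    rcases eq_or_ne c 0 with rfl | hc
    · rw [norm_zero, zero_mul]
      exact modulus_nonneg _ _
    · have h := key c⁻¹ (c • f)
      rw [smul_smul, inv_mul_cancel₀ hc, one_smul, norm_inv] at h
      have hc' : 0 < ‖c‖ := norm_pos_iff.2 hc
      calc ‖c‖ * ‖f‖ ≤ ‖c‖ * (‖c‖⁻¹ * ‖c • f‖) := by gcongr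
        _ = ‖c • f‖ := by field_simp
  norm_triangle f g := by
    refine Holder.norm_le (add_nonneg (modulus_nonneg _ _) (modulus_nonneg _ _)) fun s t => ?_
    calc ‖(f + g) t - (f + g) s‖ = ‖(f t - f s) + (g t - g s)‖ := by
          congr 1; simp only [Holder.add_apply]; ring
      _ ≤ ‖f t - f s‖ + ‖g t - g s‖ := norm_add_le _ _
      _ ≤ _ := by rw [add_mul]; exact add_le_add (f.norm_sub_apply_le s t) (g.norm_sub_apply_le s t)
  norm_eq_zero_iff f := by
    constructor
    · intro h
      ext x
      have := f.norm_sub_apply_le 0 x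
      rw [h, zero_mul, f.map_zero, sub_zero] at this
      simpa using this
    · rintro rfl
      exact le_antisymm (Holder.norm_le le_rfl fun s t => by simp) (modulus_nonneg _ _)

instance : NormedAddCommGroup (Holder β 𝕜) := NormedAddCommGroup.ofCore Holder.core

instance : NormedSpace ℝ (Holder β 𝕜) := NormedSpace.ofCore Holder.core

theorem Holder.norm_apply_le (f : Holder β 𝕜) (x : unitInterval) :
    ‖f x‖ ≤ ‖f‖ * |(x : ℝ)| ^ β := by
  simpa [f.map_zero] using f.norm_sub_apply_le 0 x

instance : CompleteSpace (Holder β 𝕜) := by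
  refine Metric.complete_of_cauchySeq_tendsto fun u hu => ?_
  have hpt : ∀ x, ∃ y, Tendsto (fun n => u n x) atTop (𝓝 y) := fun x => by
    refine cauchySeq_tendsto_of_complete ?_
    rw [Metric.cauchySeq_iff] at hu ⊢
    intro ε hε
    have hK : 0 < |(x : ℝ)| ^ β + 1 := by positivity
    obtain ⟨N, hN⟩ := hu (ε / (|(x : ℝ)| ^ β + 1)) (by positivity)
    refine ⟨N, fun m hm n hn => ?_⟩
    have h1 := hN m hm n hn
    rw [dist_eq_norm, lt_div_iff₀ hK] at h1
    have h2 := (u m - u n).norm_apply_le x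
    rw [Holder.sub_apply] at h2
    rw [dist_eq_norm]
    nlinarith [norm_nonneg (u m - u n)]
  choose g hg using hpt
  have hlim : ∀ ε : ℝ, 0 < ε → ∃ N, ∀ n ≥ N, ∀ s t : unitInterval,
      ‖(u n t - g t) - (u n s - g s)‖ ≤ ε * |(t : ℝ) - s| ^ β := fun ε hε => by
    obtain ⟨N, hN⟩ := Metric.cauchySeq_iff.1 hu ε hε
    refine ⟨N, fun n hn s t => ?_⟩
    have hT : Tendsto (fun m => ‖(u n t - u m t) - (u n s - u m s)‖) atTop
        (𝓝 ‖(u n t - g t) - (u n s - g s)‖) :=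
      (((hg t).const_sub _).sub ((hg s).const_sub _)).norm
    refine le_of_tendsto hT ?_
    filter_upwards [eventually_ge_atTop N] with m hm
    have h1 := (u n - u m).norm_sub_apply_le s t
    have h2 := hN n hn m hm
    rw [dist_eq_norm] at h2
    exact h1.trans (mul_le_mul_of_nonneg_right h2.le (by positivity))
  have hgmem : g ∈ holderSubmodule β 𝕜 := by
    refine ⟨tendsto_nhds_unique (hg 0) (by simp [Holder.map_zero]), ?_⟩
    obtain ⟨N, hN⟩ := hlim 1 one_pos
    refine ⟨‖u N‖ + 1, fun s t => ?_⟩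
    have h1 := hN N le_rfl s t
    have h2 := (u N).norm_sub_apply_le s t
    calc ‖g t - g s‖ = ‖(u N t - u N s) - ((u N t - g t) - (u N s - g s))‖ := by
          congr 1; ring
      _ ≤ ‖u N t - u N s‖ + ‖(u N t - g t) - (u N s - g s)‖ := norm_sub_le _ _
      _ ≤ _ := by linarith
  let G : Holder β 𝕜 := ⟨g, hgmem⟩
  refine ⟨G, Metric.tendsto_atTop.2 fun ε hε => ?_⟩
  obtain ⟨N, hN⟩ := hlim (ε / 2) (by positivity)
  refine ⟨N, fun n hn => ?_⟩
  rw [dist_eq_norm]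
  exact (Holder.norm_le (f := u n - G) (by positivity) (hN n hn)).trans_lt (by linarith)

/-- The little Hölder space `H_0^β = { f ∈ H^β : ω_β(f, δ) → 0 as δ → 0 }`. -/
def littleHolder (β : ℝ) (𝕜 : Type*) [RCLike 𝕜] : Set (Holder β 𝕜) :=
  {f | Tendsto (fun δ : ℝ => modulus β f δ) (𝓝[>] 0) (𝓝 0)}

/-- A function on `[0,1]`, extended to `ℝ` by its end values. Only values and one-sided
derivatives on `[0,1]` are used. -/
def extend (f : unitInterval → 𝕜) : ℝ → 𝕜 := Set.IccExtend zero_le_one f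

theorem extend_add (f g : unitInterval → 𝕜) : extend (f + g) = extend f + extend g := rfl

theorem extend_smul (c : ℝ) (f : unitInterval → 𝕜) : extend (c • f) = c • extend f := rfl

theorem extend_zero_apply (f : Holder β 𝕜) : extend f 0 = 0 := by
  rw [extend, Set.IccExtend_of_mem zero_le_one _ (left_mem_Icc.2 zero_le_one)]
  exact f.map_zero

/-! ### The derivative -/

/-- `A = d/dx` on `H^β`, with domain `D(A) = { f ∈ H^β : f' ∈ H^β }`: `f` is differentiable on
`[0,1]` (one-sidedly at the end points) and `f'` belongs to `H^β`. -/
def derivOp (β : ℝ) (𝕜 : Type*) [RCLike 𝕜] : Holder β 𝕜 →ₗ.[ℝ] Holder β 𝕜 where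
  domain :=
    { carrier := {f | (∀ x : unitInterval,
          DifferentiableWithinAt ℝ (extend f) (Icc 0 1) (x : ℝ)) ∧
        (fun x : unitInterval => derivWithin (extend f) (Icc 0 1) (x : ℝ)) ∈
          holderSubmodule β 𝕜}
      zero_mem' := by
        have h0 : extend (0 : Holder β 𝕜) = fun _ => (0 : 𝕜) := rfl
        refine ⟨fun x => ?_, ?_⟩
        · rw [h0]; exact differentiableWithinAt_const _
        · rw [h0]; simp only [derivWithin_fun_const]; exact (holderSubmodule β 𝕜).zero_mem
      add_mem' := by
        rintro f g ⟨hf, hf'⟩ ⟨hg, hg'⟩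
        refine ⟨fun x => (hf x).add (hg x), ?_⟩
        convert (holderSubmodule β 𝕜).add_mem hf' hg' using 1
        funext x
        exact derivWithin_add (hf x) (hg x)
      smul_mem' := by
        rintro c f ⟨hf, hf'⟩
        refine ⟨fun x => (hf x).const_smul c, ?_⟩
        convert (holderSubmodule β 𝕜).smul_mem c hf' using 1
        funext x
        exact derivWithin_const_smul c (hf x) }
  toFun :=
    { toFun := fun f =>
        ⟨fun x : unitInterval => derivWithin (extend f.1) (Icc 0 1) (x : ℝ), f.2.2⟩
      map_add' := fun f g => Holder.ext fun x => derivWithin_add (f.2.1 x) (g.2.1 x)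
      map_smul' := fun c f => Holder.ext fun x => derivWithin_const_smul c (f.2.1 x) }

/-- The space `X_β = { f ∈ H^β : f' ∈ H_0^β }`, a subset of `D(A)`. -/
def X (β : ℝ) (𝕜 : Type*) [RCLike 𝕜] : Set (derivOp β 𝕜).domain :=
  {f | derivOp β 𝕜 f ∈ littleHolder β 𝕜}

/-! ### The extended nabla operator -/

/-- The backward difference quotient `∇_h F (x) = (F x - F (x - h)) / h` for `x ≥ h` and
`∇_h F (x) = F x / h` for `0 ≤ x < h`. -/
def nabla (h : ℝ) (F : ℝ → 𝕜) (x : ℝ) : 𝕜 :=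
  if h ≤ x then h⁻¹ • (F x - F (x - h)) else h⁻¹ • F x

/-- Piecewise linear interpolation of `F` with nodes `t_k = k h`, `k = 0, …, n`, for `F 0 = 0`.
The cells are half open, so that a common node of two cells is counted once. -/
def interp (n : ℕ) (h : ℝ) (F : ℝ → 𝕜) (x : ℝ) : 𝕜 :=
  ∑ k ∈ Finset.Icc 1 n, (Ioc (((k : ℝ) - 1) * h) (k * h)).indicator
    (fun y => ((y - ((k : ℝ) - 1) * h) / h) • F (k * h) +
      ((k * h - y) / h) • F (((k : ℝ) - 1) * h)) x

theorem nabla_add (h : ℝ) (F G : ℝ → 𝕜) : nabla h (F + G) = nabla h F + nabla h G := by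
  funext x
  simp only [nabla, Pi.add_apply]
  split_ifs
  · rw [← smul_add]; congr 1; ring
  · rw [smul_add]

theorem nabla_smul (h c : ℝ) (F : ℝ → 𝕜) : nabla h (c • F) = c • nabla h F := by
  funext x
  simp only [nabla, Pi.smul_apply]
  split_ifs
  · rw [← smul_sub, smul_comm]
  · rw [smul_comm]

theorem interp_add (n : ℕ) (h : ℝ) (F G : ℝ → 𝕜) :
    interp n h (F + G) = interp n h F + interp n h G := by
  funext x
  simp only [interp, Pi.add_apply, ← Finset.sum_add_distrib]
  refine Finset.sum_congr rfl fun k _ => ?_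
  by_cases hx : x ∈ Ioc (((k : ℝ) - 1) * h) (k * h)
  · simp only [Set.indicator_of_mem hx, smul_add]; ring
  · simp only [Set.indicator_of_notMem hx, add_zero]

theorem interp_smul (n : ℕ) (h c : ℝ) (F : ℝ → 𝕜) :
    interp n h (c • F) = c • interp n h F := by
  funext x
  simp only [interp, Pi.smul_apply, Finset.smul_sum]
  refine Finset.sum_congr rfl fun k _ => ?_
  by_cases hx : x ∈ Ioc (((k : ℝ) - 1) * h) (k * h)
  · simp only [Set.indicator_of_mem hx, smul_add, smul_comm c]
  · simp only [Set.indicator_of_notMem hx, smul_zero]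

theorem interp_zero_apply (n : ℕ) {h : ℝ} (hh : 0 ≤ h) (F : ℝ → 𝕜) : interp n h F 0 = 0 := by
  refine Finset.sum_eq_zero fun k hk => Set.indicator_of_notMem ?_ _
  have hk1 : (1 : ℝ) ≤ k := by exact_mod_cast (Finset.mem_Icc.1 hk).1
  intro h0
  have := h0.1
  nlinarith

/-- The polygonal line as a sum of ramps. -/
theorem interp_eq_sum_ramp {h : ℝ} (hh : 0 < h) (F : ℝ → 𝕜) (hF : F 0 = 0) (n : ℕ) {x : ℝ}
    (hx : x ≤ n * h) :
    interp n h F x = ∑ k ∈ Finset.Icc 1 n,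
      max 0 (min 1 ((x - ((k : ℝ) - 1) * h) / h)) • (F (k * h) - F (((k : ℝ) - 1) * h)) := by
  induction n with
  | zero => simp [interp]
  | succ n ih =>
    have hsplit : interp (n + 1) h F x = interp n h F x +
        (Ioc ((((n + 1 : ℕ) : ℝ) - 1) * h) ((n + 1 : ℕ) * h)).indicator
          (fun y => ((y - (((n + 1 : ℕ) : ℝ) - 1) * h) / h) • F ((n + 1 : ℕ) * h) +
            (((n + 1 : ℕ) * h - y) / h) • F ((((n + 1 : ℕ) : ℝ) - 1) * h)) x :=
      Finset.sum_Icc_succ_top (by omega) _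
    rw [hsplit, Finset.sum_Icc_succ_top (by omega)]
    have hc : (((n + 1 : ℕ) : ℝ) - 1) = n := by push_cast; ring
    rw [hc]
    rcases le_or_gt x (n * h) with hxn | hxn
    · rw [ih hxn, Set.indicator_of_notMem (fun hm => absurd hm.1 (not_lt.2 hxn))]
      have : max 0 (min 1 ((x - (n : ℝ) * h) / h)) = 0 :=
        max_eq_left ((min_le_right _ _).trans
          (div_nonpos_of_nonpos_of_nonneg (by linarith) hh.le))
      rw [this, zero_smul]
    · have h1 : interp n h F x = 0 := by
        refine Finset.sum_eq_zero fun k hk => Set.indicator_of_notMem ?_ _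
        have hk1 : (k : ℝ) ≤ n := by exact_mod_cast (Finset.mem_Icc.1 hk).2
        intro hm
        have := hm.2
        nlinarith
      have h2 : ∀ m ≤ n, ∑ k ∈ Finset.Icc 1 m,
          max 0 (min 1 ((x - ((k : ℝ) - 1) * h) / h)) •
            (F (k * h) - F (((k : ℝ) - 1) * h)) = F (m * h) := by
        intro m
        induction m with
        | zero => intro _; simp [hF]
        | succ m ihm =>
          intro hm
          have hm' : (m : ℝ) + 1 ≤ n := by exact_mod_cast hm
          rw [Finset.sum_Icc_succ_top (by omega), ihm (by omega)]
          have hc' : (((m + 1 : ℕ) : ℝ) - 1) = m := by push_cast; ring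
          rw [hc']
          have : min 1 ((x - (m : ℝ) * h) / h) = 1 := by
            refine min_eq_left ((le_div_iff₀ hh).2 ?_)
            nlinarith
          rw [this, max_eq_right zero_le_one, one_smul]
          ring
      have hmem : x ∈ Ioc ((n : ℝ) * h) (((n + 1 : ℕ) : ℝ) * h) := ⟨hxn, hx⟩
      rw [h1, h2 n le_rfl, Set.indicator_of_mem hmem]
      push_cast at hx
      have h3 : max 0 (min 1 ((x - (n : ℝ) * h) / h)) = (x - n * h) / h := by
        rw [min_eq_right ((div_le_one hh).2 (by linarith)),
          max_eq_right (div_nonneg (by linarith) hh.le)]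
      have h4 : ((((n + 1 : ℕ) : ℝ) * h - x) / h) = 1 - (x - n * h) / h := by
        push_cast; field_simp; ring
      rw [h3, h4, sub_smul, one_smul, smul_sub]
      ring

/-- For `h = 1/n`, polygonal lines belong to `H^β`. -/
theorem interp_mem (hβ : β ≤ 1) (n : ℕ) (F : ℝ → 𝕜) (hF : F 0 = 0) :
    (fun x : unitInterval => interp n (1 / n) F x) ∈ holderSubmodule β 𝕜 := by
  refine ⟨interp_zero_apply n (by positivity) F, ?_⟩
  rcases Nat.eq_zero_or_pos n with rfl | hn
  · exact ⟨0, fun s t => by simp [interp]⟩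
  set h : ℝ := 1 / n with hdef
  have hn' : (0 : ℝ) < n := by exact_mod_cast hn
  have hh : 0 < h := by positivity
  have hnh : (n : ℝ) * h = 1 := by rw [hdef]; field_simp
  refine ⟨∑ k ∈ Finset.Icc 1 n, h⁻¹ * ‖F (k * h) - F (((k : ℝ) - 1) * h)‖, fun s t => ?_⟩
  have hlip : ∀ a b : ℝ, |max 0 (min 1 a) - max 0 (min 1 b)| ≤ |a - b| := fun a b =>
    (abs_max_sub_max_le_max _ _ _ _).trans (by
      rw [sub_self, abs_zero, max_eq_right (abs_nonneg _)]
      refine (abs_min_sub_min_le_max _ _ _ _).trans ?_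
      rw [sub_self, abs_zero, max_eq_right (abs_nonneg _)])
  have hts : |(t : ℝ) - s| ≤ |(t : ℝ) - s| ^ β := by
    rcases eq_or_ne t s with rfl | hne
    · simp only [sub_self, abs_zero]; positivity
    have hpos : 0 < |(t : ℝ) - s| := abs_pos.2 (sub_ne_zero.2 fun h => hne (Subtype.ext h))
    have hle : |(t : ℝ) - s| ≤ 1 := by
      rw [abs_le]; constructor <;> linarith [s.2.1, s.2.2, t.2.1, t.2.2]
    simpa using Real.rpow_le_rpow_of_exponent_ge hpos hle hβ
  simp only
  rw [interp_eq_sum_ramp hh F hF n (by rw [hnh]; exact t.2.2),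
    interp_eq_sum_ramp hh F hF n (by rw [hnh]; exact s.2.2), ← Finset.sum_sub_distrib,
    Finset.sum_mul]
  refine (norm_sum_le _ _).trans (Finset.sum_le_sum fun k _ => ?_)
  rw [← sub_smul, norm_smul, Real.norm_eq_abs]
  have h1 : |max 0 (min 1 (((t : ℝ) - ((k : ℝ) - 1) * h) / h)) -
      max 0 (min 1 (((s : ℝ) - ((k : ℝ) - 1) * h) / h))| ≤ h⁻¹ * |(t : ℝ) - s| ^ β := by
    refine (hlip _ _).trans ?_
    have : ((t : ℝ) - ((k : ℝ) - 1) * h) / h - ((s : ℝ) - ((k : ℝ) - 1) * h) / h =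
        h⁻¹ * ((t : ℝ) - s) := by field_simp; ring
    rw [this, abs_mul, abs_of_pos (inv_pos.2 hh)]
    gcongr
  calc _ ≤ h⁻¹ * |(t : ℝ) - s| ^ β * ‖F (k * h) - F (((k : ℝ) - 1) * h)‖ := by gcongr
    _ = _ := by ring

theorem nabla_extend_zero (n : ℕ) (f : Holder β 𝕜) : nabla (1 / n) (extend f) 0 = 0 := by
  unfold nabla
  split_ifs with hh
  · have h0 : (1 / n : ℝ) = 0 := le_antisymm hh (by positivity)
    rw [h0, inv_zero, zero_smul]
  · rw [extend_zero_apply f, smul_zero]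

/-- The extended nabla operator `A_h = I_h ∇_h` on `H^β` with step `h = 1/n`. -/
def extNabla (hβ : β ≤ 1) (n : ℕ) : Holder β 𝕜 →ₗ[ℝ] Holder β 𝕜 where
  toFun f := ⟨fun x : unitInterval => interp n (1 / n) (nabla (1 / n) (extend f)) x,
    interp_mem hβ n _ (nabla_extend_zero n f)⟩
  map_add' f g := Holder.ext fun x => congrFun (by
    rw [show extend (f + g : Holder β 𝕜) = extend f + extend g from rfl, nabla_add, interp_add] :
      (interp n (1 / n) (nabla (1 / n) (extend (f + g : Holder β 𝕜))) : ℝ → 𝕜) =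
      interp n (1 / n) (nabla (1 / n) (extend f)) +
        interp n (1 / n) (nabla (1 / n) (extend g))) (x : ℝ)
  map_smul' c f := Holder.ext fun x => congrFun (by
    rw [← interp_smul, ← nabla_smul]
    rfl :
      (interp n (1 / n) (nabla (1 / n) (extend (c • f : Holder β 𝕜))) : ℝ → 𝕜) =
        c • interp n (1 / n) (nabla (1 / n) (extend f))) (x : ℝ)

/-! ### Fractional powers -/

/-- `R = (l + B)⁻¹`, i.e. `-l` belongs to the resolvent set of `B` and `R = -R(-l, B)`: the map
`l + B : D(B) → Z` is a bijection and its inverse is the bounded operator `R`. -/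
def IsResolvent {Z : Type*} [NormedAddCommGroup Z] [NormedSpace ℝ Z]
    (B : Z →ₗ.[ℝ] Z) (l : ℝ) (R : Z →L[ℝ] Z) : Prop :=
  (∀ g : Z, ∃ hg : R g ∈ B.domain, l • R g + B ⟨R g, hg⟩ = g) ∧
    ∀ u : B.domain, R (l • (u : Z) + B u) = u

open Classical in
/-- The bounded operator `(l + B)⁻¹` (and `0` if `-l` is not in the resolvent set). -/
def resolventNeg {Z : Type*} [NormedAddCommGroup Z] [NormedSpace ℝ Z]
    (B : Z →ₗ.[ℝ] Z) (l : ℝ) : Z →L[ℝ] Z :=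
  if h : ∃ R : Z →L[ℝ] Z, IsResolvent B l R then h.choose else 0

/-- The Balakrishnan integral of `B` at `f` makes sense: every `l > 0` has `-l` in the resolvent
set of `B`, and `l ↦ l^(α-1) (l + B)⁻¹ B f` is Bochner integrable on `(0, ∞)`. -/
def HasFracPow {Z : Type*} [NormedAddCommGroup Z] [NormedSpace ℝ Z]
    (B : Z →ₗ.[ℝ] Z) (α : ℝ) (f : B.domain) : Prop :=
  (∀ l : ℝ, 0 < l → ∃ R : Z →L[ℝ] Z, IsResolvent B l R) ∧
    IntegrableOn (fun l : ℝ => l ^ (α - 1) • resolventNeg B l (B f)) (Ioi 0)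

/-- The fractional power of `B` on `D(B)`, by the Balakrishnan representation
`B^α f = (sin (α π) / π) ∫_0^∞ l^(α-1) (l + B)⁻¹ B f dl` for `0 < α < 1`. -/
def fracPow {Z : Type*} [NormedAddCommGroup Z] [NormedSpace ℝ Z]
    (B : Z →ₗ.[ℝ] Z) (α : ℝ) (f : B.domain) : Z :=
  (Real.sin (α * Real.pi) / Real.pi) •
    ∫ l in Ioi (0 : ℝ), l ^ (α - 1) • resolventNeg B l (B f)

/-- The fractional derivative `A^α f`, for `f ∈ D(A)`. -/
def fracDeriv (α : ℝ) (f : (derivOp β 𝕜).domain) : Holder β 𝕜 :=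
  fracPow (derivOp β 𝕜) α f

/-- The everywhere defined operator `A_h`, `h = 1/n`, in the format of unbounded operators. -/
def extNablaOp (hβ : β ≤ 1) (n : ℕ) : Holder β 𝕜 →ₗ.[ℝ] Holder β 𝕜 :=
  (extNabla hβ n).toPMap ⊤

/-- The fractional extended nabla operator `A_h^α f`, `h = 1/n`, for `f ∈ H^β`. -/
def fracExtNabla (hβ : β ≤ 1) (α : ℝ) (n : ℕ) (f : Holder β 𝕜) : Holder β 𝕜 :=
  fracPow (extNablaOp hβ n) α ⟨f, Submodule.mem_top⟩

/-- The number `C = 1/(1-α) - Γ(2-α) + 1 + (α/2) ζ(1+α)`. -/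
def errC (α : ℝ) : ℝ :=
  1 / (1 - α) - Real.Gamma (2 - α) + 1 + α / 2 * (riemannZeta ((1 + α : ℝ) : ℂ)).re

end FracNabla

end

/-!
Write `g = f'`, extended by zero to the left of `0`, and let `T_r` be the translation
`T_r g = g(· - r)`; it is a contraction of `H^β`, and vanishes for `r ≥ 1`.

The resolvent of `A` is the Laplace transform of the translations,
`(l + A)⁻¹ = ∫_0^1 e^{-ls} T_s ds` (`isResolvent_derivResolvent`), and hence
`A^α f = Γ(1-α)⁻¹ ∫_0^1 s^{-α} T_s g ds` (`fracDeriv_apply`). The translations are not strongly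
continuous on all of `H^β`, so these integrals are taken pointwise, and evaluation at a point is
used to exchange them with the Bochner integral over `l`.

For the discrete operator, `A_h = h⁻¹ (1 - T_h) I_h`, where the polygonal interpolation `I_h` is a
contractive projection commuting with `T_h`, and `T_h^n = 0`. A finite Neumann series gives the
resolvent (`isResolvent_nablaResolvent`). With `p = A_h f`, which satisfies `I_h p = p`, the beta
integral of `integral_rpow_mul_inv_one_add_pow` yields
`A_h^α f = Γ(1-α)⁻¹ ∑_{m<n} h^{1-α} (Γ(m+1-α) / Γ(m+1)) T_{mh} p` (`fracExtNabla_eq`).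

Comparing the two expressions on each cell `[mh, (m+1)h]` leaves two errors.
* The weights differ by `weightError`. For `m ≥ 1`, by Gautschi's inequalities, both lie between
  `h^{1-α} (m+1)^{-α}` and `h^{1-α} m^{-α}`, so the errors telescope and their sum is `O(h^{1-α})`
  (`sum_abs_weightError_le`).
* The functions differ by `T_{mh} (T_r g - p)` with `0 ≤ r ≤ h`. As `p` is the interpolation of the
  averages of `g` over intervals of length `h`, Jensen's inequality for `x ↦ x^β` shows that
  `T_r g - p` has norm at most `2^{β+1} ω_β(g, 2h)` (`norm_sub_linInterp_backwardAvg_sub_le`).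

The sum is `norm_fracDeriv_sub_fracExtNabla_le`, which is sharper than the asserted bound; strong
convergence follows since `ω_β(g, 2h) → 0` for `g` in the little Hölder space.
-/

noncomputable section

namespace FracNabla

/-! ### Scalar integrals and Gamma quotients -/

theorem integrableOn_rpow_mul_exp_neg_mul {α s : ℝ} (hα : 0 < α) (hs : 0 < s) :
    IntegrableOn (fun l : ℝ => l ^ (α - 1) * Real.exp (-(s * l))) (Ioi 0) := by
  have := integrableOn_rpow_mul_exp_neg_mul_rpow (p := 1) (s := α - 1) (b := s) (by linarith)
    one_pos hs
  simpa using this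

/-- The Balakrishnan integral of a Laplace transform: integrating `l^(α-1)` against
`∫ e^{-ls} φ(s) ds` gives `Γ(α) ∫ s^{-α} φ(s) ds`. -/
theorem integral_rpow_smul_laplace {E : Type*} [NormedAddCommGroup E] [NormedSpace ℝ E]
    [CompleteSpace E] {α : ℝ} (hα : 0 < α) {φ : ℝ → E}
    (hφ : IntegrableOn (fun s : ℝ => s ^ (-α) • φ s) (Ioi 0)) :
    IntegrableOn (fun l : ℝ => l ^ (α - 1) • ∫ s in Ioi (0 : ℝ), Real.exp (-(l * s)) • φ s)
        (Ioi 0) ∧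
      ∫ l in Ioi (0 : ℝ), l ^ (α - 1) • ∫ s in Ioi (0 : ℝ), Real.exp (-(l * s)) • φ s =
        Real.Gamma α • ∫ s in Ioi (0 : ℝ), s ^ (-α) • φ s := by
  set μ : Measure ℝ := volume.restrict (Ioi (0 : ℝ)) with hμ
  have hpos : ∀ᵐ s ∂μ, 0 < s := ae_restrict_mem measurableSet_Ioi
  have hφm : AEStronglyMeasurable φ μ := by
    have h1 : AEStronglyMeasurable (fun s : ℝ => s ^ α • (s ^ (-α) • φ s)) μ :=
      (Measurable.aestronglyMeasurable (by fun_prop)).smul hφ.aestronglyMeasurable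
    refine h1.congr ?_
    filter_upwards [hpos] with s hs
    rw [smul_smul, ← Real.rpow_add hs, add_neg_cancel, Real.rpow_zero, one_smul]
  have hval : ∀ s : ℝ, 0 < s →
      ∫ l, l ^ (α - 1) * Real.exp (-(s * l)) ∂μ = Real.Gamma α * s ^ (-α) := fun s hs => by
    rw [Real.integral_rpow_mul_exp_neg_mul_Ioi hα hs, one_div, Real.inv_rpow hs.le,
      Real.rpow_neg hs.le, mul_comm]
  have hF : Integrable (fun z : ℝ × ℝ =>
      (z.1 ^ (α - 1) * Real.exp (-(z.2 * z.1))) • φ z.2) (μ.prod μ) := by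
    rw [integrable_prod_iff']
    · refine ⟨?_, ?_⟩
      · filter_upwards [hpos] with s hs
        exact (integrableOn_rpow_mul_exp_neg_mul hα hs).smul_const _
      · refine (hφ.norm.const_mul (Real.Gamma α)).congr ?_
        filter_upwards [hpos] with s hs
        have : ∀ᵐ l ∂μ, ‖(l ^ (α - 1) * Real.exp (-(s * l))) • φ s‖ =
            (l ^ (α - 1) * Real.exp (-(s * l))) * ‖φ s‖ := by
          filter_upwards [hpos] with l hl
          rw [norm_smul, Real.norm_of_nonneg (by positivity)]
        rw [integral_congr_ae this, integral_mul_const, hval s hs, norm_smul,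
          Real.norm_of_nonneg (by positivity)]
        ring
    · exact (Measurable.aestronglyMeasurable (by fun_prop)).smul hφm.comp_snd
  have hinner : ∀ l : ℝ, ∫ s, (l ^ (α - 1) * Real.exp (-(s * l))) • φ s ∂μ =
      l ^ (α - 1) • ∫ s, Real.exp (-(l * s)) • φ s ∂μ := fun l => by
    rw [← integral_smul]
    simp only [smul_smul, mul_comm l]
  refine ⟨?_, ?_⟩
  · exact hF.integral_prod_left.congr (ae_of_all _ hinner)
  · rw [← integral_congr_ae (ae_of_all μ hinner), integral_integral_swap hF, ← integral_smul]
    refine integral_congr_ae ?_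
    filter_upwards [hpos] with s hs
    rw [integral_smul_const, hval s hs, smul_smul]

/-- `sin(απ)/π · Γ(α) = 1/Γ(1-α)`, by the reflection formula. -/
theorem sin_div_pi_mul_Gamma {α : ℝ} (hα0 : 0 < α) (hα1 : α < 1) :
    Real.sin (α * Real.pi) / Real.pi * Real.Gamma α = (Real.Gamma (1 - α))⁻¹ := by
  have h1 := Real.Gamma_mul_Gamma_one_sub α
  have hs : 0 < Real.sin (α * Real.pi) := Real.sin_pos_of_pos_of_lt_pi
    (by positivity) (by nlinarith [Real.pi_pos])
  have hG : 0 < Real.Gamma (1 - α) := Real.Gamma_pos_of_pos (by linarith)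
  rw [mul_comm Real.pi α] at h1
  have := Real.pi_pos
  field_simp at h1 ⊢
  linarith

/-- A beta integral: `∫ l^(α-1) (1+lh)^{-m} dl = h^{-α} Γ(α) Γ(m-α) / Γ(m)`. It is a
Balakrishnan integral of a Laplace transform, since `(1+lh)^{-m}` is the Laplace transform of a
Gamma density. -/
theorem integral_rpow_mul_inv_one_add_pow {α h : ℝ} (hα0 : 0 < α) (hα1 : α < 1) (hh : 0 < h)
    (m : ℕ) :
    IntegrableOn (fun l : ℝ => l ^ (α - 1) * ((1 + l * h)⁻¹) ^ (m + 1)) (Ioi 0) ∧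
      ∫ l in Ioi (0 : ℝ), l ^ (α - 1) * ((1 + l * h)⁻¹) ^ (m + 1) =
        Real.Gamma α * (h ^ (-α) * (Real.Gamma (m + (1 - α)) / Real.Gamma (m + 1))) := by
  have hGm : 0 < Real.Gamma ((m : ℝ) + 1) := Real.Gamma_pos_of_pos (by positivity)
  have hr : 0 < 1 / h := by positivity
  set φ : ℝ → ℝ := fun s => (h ^ (m + 1) * Real.Gamma (m + 1))⁻¹ *
    (s ^ ((m : ℝ) + 1 - 1) * Real.exp (-(1 / h * s))) with hφdef
  have hlap : ∀ l : ℝ, 0 < l →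
      ∫ s in Ioi (0 : ℝ), Real.exp (-(l * s)) • φ s = ((1 + l * h)⁻¹) ^ (m + 1) := by
    intro l hl
    have h1 : ∀ s : ℝ, Real.exp (-(l * s)) • φ s = (h ^ (m + 1) * Real.Gamma (m + 1))⁻¹ *
        (s ^ ((m : ℝ) + 1 - 1) * Real.exp (-((l + 1 / h) * s))) := fun s => by
      have : Real.exp (-((l + 1 / h) * s)) =
          Real.exp (-(l * s)) * Real.exp (-(1 / h * s)) := by
        rw [← Real.exp_add]; ring_nf
      rw [hφdef, this, smul_eq_mul]; ring
    simp only [h1]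
    rw [integral_const_mul,
      Real.integral_rpow_mul_exp_neg_mul_Ioi (by positivity) (by positivity)]
    have h2 : ((m : ℝ) + 1) = ((m + 1 : ℕ) : ℝ) := by push_cast; ring
    have h3 : (1 / (l + 1 / h) : ℝ) = h * (1 + l * h)⁻¹ := by field_simp; ring
    rw [h3]
    nth_rw 2 [h2]
    rw [Real.rpow_natCast, mul_pow]
    field_simp
  have hs : ∀ s ∈ Ioi (0 : ℝ), s ^ (-α) • φ s = (h ^ (m + 1) * Real.Gamma (m + 1))⁻¹ *
      (s ^ ((m : ℝ) + (1 - α) - 1) * Real.exp (-(1 / h * s))) := by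
    intro s hs
    have : s ^ ((m : ℝ) + (1 - α) - 1) = s ^ (-α) * s ^ ((m : ℝ) + 1 - 1) := by
      rw [← Real.rpow_add hs]; ring_nf
    rw [hφdef, this, smul_eq_mul]; ring
  have hφi : IntegrableOn (fun s : ℝ => s ^ (-α) • φ s) (Ioi 0) := by
    refine IntegrableOn.congr_fun ?_ (fun s h => (hs s h).symm) measurableSet_Ioi
    exact (integrableOn_rpow_mul_exp_neg_mul
      (by have : (0 : ℝ) ≤ m := by positivity
          linarith) hr).const_mul _
  obtain ⟨h1, h2⟩ := integral_rpow_smul_laplace hα0 hφi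
  have hc : ∀ l ∈ Ioi (0 : ℝ), l ^ (α - 1) • ∫ s in Ioi (0 : ℝ), Real.exp (-(l * s)) • φ s =
      l ^ (α - 1) * ((1 + l * h)⁻¹) ^ (m + 1) := fun l hl => by rw [hlap l hl, smul_eq_mul]
  refine ⟨h1.congr_fun hc measurableSet_Ioi, ?_⟩
  rw [← setIntegral_congr_fun measurableSet_Ioi hc, h2, smul_eq_mul,
    setIntegral_congr_fun measurableSet_Ioi hs, integral_const_mul,
    Real.integral_rpow_mul_exp_neg_mul_Ioi
      (by have : (0 : ℝ) ≤ m := by positivity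
          linarith) hr]
  have h3 : (1 / (1 / h) : ℝ) ^ ((m : ℝ) + (1 - α)) = h ^ (m + 1) * h ^ (-α) := by
    rw [one_div_one_div, ← Real.rpow_natCast, ← Real.rpow_add hh]
    push_cast; ring_nf
  rw [h3]
  field_simp

/-- `∫_{mh}^{(m+1)h} s^{-α} ds - h^{1-α} Γ(m+1-α) / Γ(m+1)`: up to the factor `1/Γ(1-α)`, the
difference of the weights of the fractional integral and of its discrete analogue on a cell. -/
def weightError (α h : ℝ) (m : ℕ) : ℝ :=
  (∫ s in (m * h : ℝ)..((m : ℝ) + 1) * h, s ^ (-α)) -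
    h ^ (1 - α) * (Real.Gamma (m + (1 - α)) / Real.Gamma (m + 1))

/-- Log-convexity of `Γ` on `[1, 2]`, where both end values are `1`. -/
theorem Gamma_two_sub_le_one {α : ℝ} (hα0 : 0 < α) (hα1 : α < 1) : Real.Gamma (2 - α) ≤ 1 := by
  have h := Real.Gamma_mul_add_mul_le_rpow_Gamma_mul_rpow_Gamma (s := 1) (t := 2) (a := α)
    (b := 1 - α) one_pos two_pos hα0 (by linarith) (by ring)
  have h2 : α * 1 + (1 - α) * 2 = 2 - α := by ring
  rw [h2] at h
  simpa [Real.Gamma_two] using h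

theorem Gamma_two_sub {α : ℝ} (hα1 : α < 1) :
    Real.Gamma (2 - α) = (1 - α) * Real.Gamma (1 - α) := by
  rw [← Real.Gamma_add_one (by linarith)]; ring_nf

/-- Gautschi's inequalities, from the log-convexity of `Γ`. -/
theorem Gamma_div_Gamma_mem_Icc {α : ℝ} (hα0 : 0 < α) (hα1 : α < 1) {m : ℕ} (hm : 1 ≤ m) :
    Real.Gamma (m + (1 - α)) / Real.Gamma (m + 1) ∈
      Icc (((m : ℝ) + 1) ^ (-α)) ((m : ℝ) ^ (-α)) := by
  have hm0 : (1 : ℝ) ≤ m := by exact_mod_cast hm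
  have hG0 : 0 < Real.Gamma (m : ℝ) := Real.Gamma_pos_of_pos (by linarith)
  have hG1 : 0 < Real.Gamma ((m : ℝ) + 1) := Real.Gamma_pos_of_pos (by linarith)
  have hG2 : 0 < Real.Gamma ((m : ℝ) + (1 - α)) := Real.Gamma_pos_of_pos (by linarith)
  constructor
  · have h := Real.Gamma_mul_add_mul_le_rpow_Gamma_mul_rpow_Gamma (s := (m : ℝ) + (1 - α))
      (t := (m : ℝ) + (1 - α) + 1) (a := 1 - α)
      (b := α) (by linarith) (by linarith) (by linarith) hα0 (by ring)
    have e : (1 - α) * ((m : ℝ) + (1 - α)) + α * ((m : ℝ) + (1 - α) + 1) = m + 1 := by ring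
    have hp : (0 : ℝ) < m + (1 - α) := by linarith
    rw [e, Real.Gamma_add_one (s := (m : ℝ) + (1 - α)) hp.ne', Real.mul_rpow hp.le hG2.le,
      mul_left_comm, ← Real.rpow_add hG2] at h
    rw [sub_add_cancel, Real.rpow_one] at h
    rw [Real.rpow_neg (by positivity), le_div_iff₀ hG1, inv_mul_le_iff₀ (by positivity)]
    refine h.trans ?_
    gcongr
    linarith
  · have h := Real.Gamma_mul_add_mul_le_rpow_Gamma_mul_rpow_Gamma (s := (m : ℝ))
      (t := (m : ℝ) + 1) (a := α)
      (b := 1 - α) (by linarith) (by linarith) hα0 (by linarith) (by ring)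
    have e : α * (m : ℝ) + (1 - α) * ((m : ℝ) + 1) = m + (1 - α) := by ring
    have hm1 : Real.Gamma (m : ℝ) = Real.Gamma ((m : ℝ) + 1) * (m : ℝ)⁻¹ := by
      rw [Real.Gamma_add_one (by positivity)]; field_simp
    rw [e, hm1, Real.mul_rpow hG1.le (by positivity), mul_right_comm, ← Real.rpow_add hG1,
      add_sub_cancel, Real.rpow_one, Real.inv_rpow (by positivity)] at h
    rw [Real.rpow_neg (by positivity), div_le_iff₀ hG1]
    linarith

theorem intervalIntegrable_rpow_neg {α : ℝ} (hα1 : α < 1) (a b : ℝ) :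
    IntervalIntegrable (fun s : ℝ => s ^ (-α)) volume a b :=
  intervalIntegral.intervalIntegrable_rpow' (by linarith)

theorem integral_rpow_neg_zero_one {α : ℝ} (hα1 : α < 1) :
    ∫ s in (0 : ℝ)..1, s ^ (-α) = 1 / (1 - α) := by
  rw [integral_rpow (Or.inl (by linarith)), Real.one_rpow, Real.zero_rpow (by linarith)]
  ring_nf

theorem abs_weightError_zero_le {α h : ℝ} (hα0 : 0 < α) (hα1 : α < 1) (hh : 0 < h) :
    |weightError α h 0| ≤ h ^ (1 - α) * (1 / (1 - α)) := by
  have hγ : 0 < 1 - α := by linarith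
  have h1 : weightError α h 0 = h ^ (1 - α) * (1 / (1 - α)) * (1 - Real.Gamma (2 - α)) := by
    unfold weightError
    rw [integral_rpow (Or.inl (by linarith)), Gamma_two_sub hα1, Nat.cast_zero, zero_mul,
      Real.zero_rpow (by linarith), neg_add_eq_sub]
    simp
    field_simp
  have h2 := Gamma_two_sub_le_one hα0 hα1
  have h3 : 0 < Real.Gamma (2 - α) := Real.Gamma_pos_of_pos (by linarith)
  rw [h1, abs_mul, abs_of_nonneg (by positivity : 0 ≤ h ^ (1 - α) * (1 / (1 - α)))]
  refine mul_le_of_le_one_right (by positivity) ?_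
  rw [abs_le]; constructor <;> linarith

theorem abs_weightError_le {α h : ℝ} (hα0 : 0 < α) (hα1 : α < 1) (hh : 0 < h) {m : ℕ}
    (hm : 1 ≤ m) :
    |weightError α h m| ≤ h ^ (1 - α) * ((m : ℝ) ^ (-α) - ((m : ℝ) + 1) ^ (-α)) := by
  have hm0 : (1 : ℝ) ≤ m := by exact_mod_cast hm
  obtain ⟨g1, g2⟩ := Gamma_div_Gamma_mem_Icc hα0 hα1 hm
  have hle : (m * h : ℝ) ≤ ((m : ℝ) + 1) * h := by nlinarith
  have hsplit : ∀ c : ℝ, 0 ≤ c → h * (c * h) ^ (-α) = h ^ (1 - α) * c ^ (-α) := fun c hc => by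
    rw [Real.mul_rpow hc hh.le, sub_eq_add_neg, Real.rpow_add hh, Real.rpow_one]; ring
  have hconst : ∀ c : ℝ, ∫ _ in (m * h : ℝ)..((m : ℝ) + 1) * h, c = h * c := fun c => by
    rw [intervalIntegral.integral_const, smul_eq_mul]; ring
  have i1 : ∫ s in (m * h : ℝ)..((m : ℝ) + 1) * h, s ^ (-α) ≤ h ^ (1 - α) * (m : ℝ) ^ (-α) := by
    rw [← hsplit _ (by positivity), ← hconst]
    refine intervalIntegral.integral_mono_on hle (intervalIntegrable_rpow_neg hα1 _ _)
      intervalIntegrable_const fun s hs => ?_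
    exact Real.rpow_le_rpow_of_nonpos (by positivity) hs.1 (by linarith)
  have i2 : h ^ (1 - α) * ((m : ℝ) + 1) ^ (-α) ≤
      ∫ s in (m * h : ℝ)..((m : ℝ) + 1) * h, s ^ (-α) := by
    rw [← hsplit _ (by positivity), ← hconst]
    refine intervalIntegral.integral_mono_on hle intervalIntegrable_const
      (intervalIntegrable_rpow_neg hα1 _ _) fun s hs => ?_
    have : 0 < s := lt_of_lt_of_le (by positivity) hs.1
    exact Real.rpow_le_rpow_of_nonpos this hs.2 (by linarith)
  have hp : 0 ≤ h ^ (1 - α) := by positivity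
  have g1' := mul_le_mul_of_nonneg_left g1 hp
  have g2' := mul_le_mul_of_nonneg_left g2 hp
  unfold weightError
  rw [abs_le]
  constructor <;> linarith

/-- The errors of the weights are summable with a bound of order `h^{1-α}`: from the second
cell on, both weights lie between `h^{1-α} (m+1)^{-α}` and `h^{1-α} m^{-α}`, and the differences of
these bounds telescope. -/
theorem sum_abs_weightError_le {α h : ℝ} (hα0 : 0 < α) (hα1 : α < 1) (hh : 0 < h) (n : ℕ) :
    ∑ m ∈ Finset.range n, |weightError α h m| ≤ h ^ (1 - α) * (1 / (1 - α) + 1) := by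
  have hγ : 0 < 1 - α := by linarith
  have key : ∀ n : ℕ, ∑ m ∈ Finset.range (n + 1), |weightError α h m| ≤
      h ^ (1 - α) * (1 / (1 - α) + 1 - ((n : ℝ) + 1) ^ (-α)) := by
    intro n
    induction n with
    | zero => simpa using abs_weightError_zero_le hα0 hα1 hh
    | succ n ih =>
      rw [Finset.sum_range_succ]
      have := abs_weightError_le hα0 hα1 hh (m := n + 1) (by omega)
      push_cast at this ⊢
      linarith
  rcases n with _ | n
  · simp only [Finset.range_zero, Finset.sum_empty]; positivity
  · refine (key n).trans ?_
    gcongr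
    linarith [Real.rpow_nonneg (show (0 : ℝ) ≤ n + 1 by positivity) (-α)]

theorem errC_nonneg {α : ℝ} (hα0 : 0 < α) (hα1 : α < 1) : 0 ≤ errC α := by
  have hz : 0 ≤ (riemannZeta ((1 + α : ℝ) : ℂ)).re := by
    have hs : 1 < (((1 + α : ℝ) : ℂ)).re := by simpa using hα0
    rw [zeta_eq_tsum_one_div_nat_cpow hs, Complex.re_tsum (Complex.summable_one_div_nat_cpow.2 hs)]
    refine tsum_nonneg fun n => ?_
    have : (1 / (n : ℂ) ^ ((1 + α : ℝ) : ℂ)) = ((1 / (n : ℝ) ^ (1 + α) : ℝ) : ℂ) := by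
      rw [Complex.ofReal_div, Complex.ofReal_cpow (by positivity)]; simp
    rw [this, Complex.ofReal_re]
    positivity
  have h1 := Gamma_two_sub_le_one hα0 hα1
  have h2 : 0 < 1 / (1 - α) := by
    have : 0 < 1 - α := by linarith
    positivity
  unfold errC
  have := mul_nonneg (by linarith : 0 ≤ α / 2) hz
  linarith

variable {𝕜 : Type*} [RCLike 𝕜] {β : ℝ}

/-! ### Extensions by zero to the left -/

theorem extend_apply_coe (f : Holder β 𝕜) (x : unitInterval) : extend f x = f x :=
  Set.IccExtend_val zero_le_one f x

theorem extend_of_nonpos (g : Holder β 𝕜) {x : ℝ} (hx : x ≤ 0) : extend g x = 0 := by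
  rw [extend, Set.IccExtend_of_le_left zero_le_one _ hx]
  exact g.map_zero

/-- A function vanishing on `(-∞, 0]` and extending `g` agrees with `extend g` up to `1`. -/
theorem extend_eq_of_le_one {g : Holder β 𝕜} {Ψ : ℝ → 𝕜} (h0 : ∀ x ≤ 0, Ψ x = 0)
    (h1 : ∀ x : unitInterval, g x = Ψ x) {x : ℝ} (hx : x ≤ 1) : extend g x = Ψ x := by
  rcases le_total x 0 with h | h
  · rw [extend_of_nonpos g h, h0 x h]
  · rw [← h1 ⟨x, h, hx⟩]
    exact extend_apply_coe g ⟨x, h, hx⟩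

theorem Holder.norm_sub_apply_le_modulus (g : Holder β 𝕜) {δ : ℝ} {s t : unitInterval}
    (hst : |(t : ℝ) - s| ≤ δ) : ‖g t - g s‖ ≤ modulus β g δ * |(t : ℝ) - s| ^ β := by
  rcases eq_or_ne s t with rfl | hne
  · simp only [sub_self, norm_zero]
    exact mul_nonneg (modulus_nonneg _ _) (by positivity)
  have hpos : 0 < |(t : ℝ) - s| :=
    abs_pos.2 (sub_ne_zero.2 fun h => hne (Subtype.ext h.symm))
  rw [← div_le_iff₀ (Real.rpow_pos_of_pos hpos β)]
  refine le_csSup ⟨‖g‖, ?_⟩ ⟨s, t, by rwa [abs_sub_comm], by rwa [abs_sub_comm], rfl⟩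
  rintro r ⟨a, b, hab, -, rfl⟩
  rw [abs_sub_comm] at hab
  rw [div_le_iff₀ (Real.rpow_pos_of_pos hab β)]
  exact g.norm_sub_apply_le a b

theorem norm_extend_sub_le (hβ0 : 0 < β) (g : Holder β 𝕜) (s t : ℝ) :
    ‖extend g t - extend g s‖ ≤ ‖g‖ * |t - s| ^ β := by
  have h := Set.abs_projIcc_sub_projIcc (a := (0 : ℝ)) (b := 1) (c := t) (d := s) zero_le_one
  refine (g.norm_sub_apply_le _ _).trans ?_
  gcongr

theorem norm_extend_sub_le_modulus (hβ0 : 0 < β) (g : Holder β 𝕜) {δ s t : ℝ}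
    (hst : |t - s| ≤ δ) : ‖extend g t - extend g s‖ ≤ modulus β g δ * |t - s| ^ β := by
  have h := Set.abs_projIcc_sub_projIcc (a := (0 : ℝ)) (b := 1) (c := t) (d := s) zero_le_one
  refine (g.norm_sub_apply_le_modulus (h.trans hst)).trans ?_
  have := modulus_nonneg (β := β) (g : unitInterval → 𝕜) δ
  gcongr

theorem continuous_extend (hβ0 : 0 < β) (g : Holder β 𝕜) : Continuous (extend g) := by
  refine continuous_iff_continuousAt.2 fun s => tendsto_iff_norm_sub_tendsto_zero.2 ?_
  refine squeeze_zero (fun _ => norm_nonneg _) (fun t => norm_extend_sub_le hβ0 g s t) ?_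
  have h : Continuous fun t : ℝ => ‖g‖ * |t - s| ^ β :=
    continuous_const.mul ((continuous_id.sub continuous_const).abs.rpow_const
      fun _ => Or.inr hβ0.le)
  have := h.tendsto s
  simpa [Real.zero_rpow hβ0.ne'] using this

/-- A linear map into functions which vanish at `0` and satisfy a uniform Hölder bound is a
bounded operator on `H^β`. -/
def Holder.mkOp (Φ : Holder β 𝕜 →ₗ[ℝ] (unitInterval → 𝕜)) (C : ℝ) (h0 : ∀ g, Φ g 0 = 0)
    (hC : 0 ≤ C)
    (hΦ : ∀ g, ∀ s t : unitInterval, ‖Φ g t - Φ g s‖ ≤ C * ‖g‖ * |(t : ℝ) - s| ^ β) :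
    Holder β 𝕜 →L[ℝ] Holder β 𝕜 :=
  LinearMap.mkContinuous
    { toFun := fun g => ⟨Φ g, h0 g, C * ‖g‖, hΦ g⟩
      map_add' := fun f g => Subtype.ext (Φ.map_add f g)
      map_smul' := fun c f => Subtype.ext (Φ.map_smul c f) }
    C fun g => Holder.norm_le (mul_nonneg hC (norm_nonneg g)) (hΦ g)

theorem Holder.norm_mkOp_apply_le (Φ : Holder β 𝕜 →ₗ[ℝ] (unitInterval → 𝕜)) (C : ℝ)
    (h0 : ∀ g, Φ g 0 = 0) (hC : 0 ≤ C)
    (hΦ : ∀ g, ∀ s t : unitInterval, ‖Φ g t - Φ g s‖ ≤ C * ‖g‖ * |(t : ℝ) - s| ^ β)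
    (g : Holder β 𝕜) : ‖Holder.mkOp Φ C h0 hC hΦ g‖ ≤ C * ‖g‖ :=
  Holder.norm_le (mul_nonneg hC (norm_nonneg g)) (hΦ g)

/-- Evaluation at a point, as a bounded functional on `H^β`. -/
def evalCLM (β : ℝ) (𝕜 : Type*) [RCLike 𝕜] (x : unitInterval) : Holder β 𝕜 →L[ℝ] 𝕜 :=
  LinearMap.mkContinuous
    { toFun := fun g => g x
      map_add' := fun _ _ => rfl
      map_smul' := fun _ _ => rfl }
    (|(x : ℝ)| ^ β) fun g => by rw [mul_comm]; exact g.norm_apply_le x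

theorem evalCLM_apply (x : unitInterval) (g : Holder β 𝕜) : evalCLM β 𝕜 x g = g x := rfl

/-! ### Translations -/

/-- The right translation `g ↦ g(· - r)`, with `g` extended by zero to the left. -/
def shift (hβ0 : 0 < β) {r : ℝ} (hr : 0 ≤ r) : Holder β 𝕜 →L[ℝ] Holder β 𝕜 :=
  Holder.mkOp
    { toFun := fun g x => extend g ((x : ℝ) - r)
      map_add' := fun _ _ => rfl
      map_smul' := fun _ _ => rfl }
    1 (fun g => extend_of_nonpos g (by simpa using hr)) zero_le_one fun g s t => by
      have := norm_extend_sub_le hβ0 g ((s : ℝ) - r) ((t : ℝ) - r)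
      rw [sub_sub_sub_cancel_right] at this
      rwa [one_mul]

theorem shift_apply (hβ0 : 0 < β) {r : ℝ} (hr : 0 ≤ r) (g : Holder β 𝕜) (x : unitInterval) :
    shift hβ0 hr g x = extend g ((x : ℝ) - r) := rfl

theorem extend_shift (hβ0 : 0 < β) {r : ℝ} (hr : 0 ≤ r) (g : Holder β 𝕜) {x : ℝ} (hx : x ≤ 1) :
    extend (shift hβ0 hr g) x = extend g (x - r) :=
  extend_eq_of_le_one (g := shift hβ0 hr g) (Ψ := fun x => extend g (x - r))
    (fun y hy => extend_of_nonpos g (by linarith)) (fun _ => rfl) hx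

theorem shift_pow_apply (hβ0 : 0 < β) {r : ℝ} (hr : 0 ≤ r) (m : ℕ) (g : Holder β 𝕜)
    (x : unitInterval) : (shift hβ0 hr ^ m) g x = extend g ((x : ℝ) - m * r) := by
  induction m generalizing g with
  | zero => simp [extend_apply_coe]
  | succ m ih =>
    rw [pow_succ, mul_apply_eq_comp, ih, extend_shift]
    · push_cast; ring_nf
    · have : 0 ≤ m * r := by positivity
      linarith [x.2.2]

theorem shift_pow_eq_zero (hβ0 : 0 < β) {r : ℝ} (hr : 0 ≤ r) {m : ℕ} (hm : 1 ≤ m * r) :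
    (shift hβ0 hr : Holder β 𝕜 →L[ℝ] Holder β 𝕜) ^ m = 0 := by
  ext g x
  rw [shift_pow_apply, extend_of_nonpos g (by linarith [x.2.2])]
  rfl

/-! ### Polygonal interpolation on the line -/

/-- The piecewise linear interpolation on all of `ℝ` with nodes `hℤ`, in the cell
`((k-1)h, kh]` with `k = ⌈x/h⌉`. It commutes with translation by `h`. -/
def linInterp (h : ℝ) (F : ℝ → 𝕜) (x : ℝ) : 𝕜 :=
  (1 - (⌈x / h⌉ - x / h)) • F (⌈x / h⌉ * h) + (⌈x / h⌉ - x / h) • F ((⌈x / h⌉ - 1) * h)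

theorem ceil_sub_mem_Icc (y : ℝ) : (⌈y⌉ : ℝ) - y ∈ Icc (0 : ℝ) 1 :=
  ⟨sub_nonneg.2 (Int.le_ceil y), by linarith [Int.ceil_lt_add_one y]⟩

theorem linInterp_int_mul {h : ℝ} (hh : 0 < h) (F : ℝ → 𝕜) (k : ℤ) :
    linInterp h F (k * h) = F (k * h) := by
  simp [linInterp, mul_div_cancel_right₀ _ hh.ne']

theorem linInterp_add (h : ℝ) (F G : ℝ → 𝕜) :
    linInterp h (F + G) = linInterp h F + linInterp h G := by
  funext x; simp only [linInterp, Pi.add_apply, smul_add]; abel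

theorem linInterp_smul (h c : ℝ) (F : ℝ → 𝕜) : linInterp h (c • F) = c • linInterp h F := by
  funext x; simp only [linInterp, Pi.smul_apply, smul_add, smul_comm c]

theorem linInterp_comp_sub {h : ℝ} (hh : 0 < h) (F : ℝ → 𝕜) (x : ℝ) :
    linInterp h (fun y => F (y - h)) x = linInterp h F (x - h) := by
  have h1 : (x - h) / h = x / h - 1 := by field_simp
  have h2 : ∀ c : ℝ, c * h - h = (c - 1) * h := fun c => by ring
  simp only [linInterp, h1, Int.ceil_sub_one, Int.cast_sub, Int.cast_one, h2,
    sub_sub_sub_cancel_right]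

theorem ceil_mul_le_one {n : ℕ} {h x : ℝ} (hh : 0 < h) (hnh : n * h = 1) (hx : x ≤ 1) :
    (⌈x / h⌉ : ℝ) * h ≤ 1 := by
  have h1 : ⌈x / h⌉ ≤ (n : ℤ) := Int.ceil_le.2 (by
    rw [div_le_iff₀ hh]; push_cast; linarith)
  have h2 : (⌈x / h⌉ : ℝ) ≤ n := by exact_mod_cast h1
  nlinarith

theorem linInterp_congr {n : ℕ} {h : ℝ} (hh : 0 < h) (hnh : n * h = 1) {F G : ℝ → 𝕜}
    (hFG : ∀ x ≤ 1, F x = G x) {x : ℝ} (hx : x ≤ 1) : linInterp h F x = linInterp h G x := by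
  have h1 := ceil_mul_le_one hh hnh hx
  rw [linInterp, linInterp, hFG _ h1, hFG ((⌈x / h⌉ - 1) * h) (by linarith)]

theorem linInterp_of_nonpos {h : ℝ} (hh : 0 < h) {F : ℝ → 𝕜} (hF : ∀ x ≤ 0, F x = 0) {x : ℝ}
    (hx : x ≤ 0) : linInterp h F x = 0 := by
  have h1 : ⌈x / h⌉ ≤ 0 := Int.ceil_le.2 (by
    simpa using div_nonpos_of_nonpos_of_nonneg hx hh.le)
  have h2 : (⌈x / h⌉ : ℝ) * h ≤ 0 :=
    mul_nonpos_of_nonpos_of_nonneg (by exact_mod_cast h1) hh.le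
  rw [linInterp, hF _ h2, hF ((⌈x / h⌉ - 1) * h) (by linarith), smul_zero, smul_zero, add_zero]

theorem interp_eq_linInterp {n : ℕ} {h : ℝ} (hh : 0 < h) (hnh : n * h = 1) {F : ℝ → 𝕜}
    (hF : F 0 = 0) (x : unitInterval) : interp n h F x = linInterp h F x := by
  rcases x.2.1.eq_or_lt with h0 | h0
  · rw [← h0, interp_zero_apply n hh.le]
    simpa [hF] using (linInterp_int_mul hh F 0).symm
  have hk0 : 0 < ⌈(x : ℝ) / h⌉ := Int.ceil_pos.2 (by positivity)
  obtain ⟨k, hk⟩ := Int.eq_ofNat_of_zero_le hk0.le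
  have hkc : (⌈(x : ℝ) / h⌉ : ℝ) = k := by rw [hk]; simp
  have hkn : k ≤ n := by
    have : ⌈(x : ℝ) / h⌉ ≤ (n : ℤ) := Int.ceil_le.2 (by
      rw [div_le_iff₀ hh]; push_cast; linarith [x.2.2])
    omega
  have hlt := Int.ceil_lt_add_one ((x : ℝ) / h)
  have hle := Int.le_ceil ((x : ℝ) / h)
  rw [hkc] at hlt hle
  rw [div_le_iff₀ hh] at hle
  rw [← sub_lt_iff_lt_add, lt_div_iff₀ hh] at hlt
  rw [interp, Finset.sum_eq_single k]
  · rw [Set.indicator_of_mem (show (x : ℝ) ∈ Ioc (((k : ℝ) - 1) * h) (k * h) from ⟨hlt, hle⟩),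
      linInterp, hkc]
    congr 2
    · field_simp
      ring
    · field_simp
  · intro j _ hjk
    refine Set.indicator_of_notMem (fun hx => ?_) _
    rcases lt_or_gt_of_ne hjk with hj | hj
    · have : (j : ℝ) ≤ k - 1 := by
        have : (j : ℝ) + 1 ≤ k := by exact_mod_cast hj
        linarith
      have := mul_le_mul_of_nonneg_right this hh.le
      linarith [hx.2]
    · have : (k : ℝ) ≤ j - 1 := by
        have : (k : ℝ) + 1 ≤ j := by exact_mod_cast hj
        linarith
      have := mul_le_mul_of_nonneg_right this hh.le
      linarith [hx.1]
  · intro hk'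
    exact absurd (Finset.mem_Icc.2 ⟨by omega, hkn⟩) hk'

/-- Jensen's inequality for the concave function `x ↦ x^β`. -/
theorem norm_convexComb_sub_le (hβ0 : 0 < β) (hβ1 : β ≤ 1) {u v w : 𝕜} {K a b θ : ℝ}
    (hK : 0 ≤ K) (ha : 0 ≤ a) (hb : 0 ≤ b) (hθ : θ ∈ Icc (0 : ℝ) 1) (hu : ‖u - w‖ ≤ K * a ^ β)
    (hv : ‖v - w‖ ≤ K * b ^ β) :
    ‖((1 - θ) • u + θ • v) - w‖ ≤ K * ((1 - θ) * a + θ * b) ^ β := by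
  have hθ1 : 0 ≤ 1 - θ := by linarith [hθ.2]
  have e : ((1 - θ) • u + θ • v) - w = (1 - θ) • (u - w) + θ • (v - w) := by
    simp only [smul_sub, sub_smul, one_smul]; abel
  have hJ := (Real.concaveOn_rpow hβ0.le hβ1).2 (x := a) (y := b) ha hb hθ1 hθ.1 (by ring)
  simp only [smul_eq_mul] at hJ
  calc ‖((1 - θ) • u + θ • v) - w‖ ≤ (1 - θ) * (K * a ^ β) + θ * (K * b ^ β) := by
        rw [e]
        refine (norm_add_le _ _).trans ?_
        rw [norm_smul, norm_smul, Real.norm_of_nonneg hθ1, Real.norm_of_nonneg hθ.1]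
        exact add_le_add (mul_le_mul_of_nonneg_left hu hθ1) (mul_le_mul_of_nonneg_left hv hθ.1)
    _ = K * ((1 - θ) * a ^ β + θ * b ^ β) := by ring
    _ ≤ _ := mul_le_mul_of_nonneg_left hJ hK

/-- Polygonal interpolation does not increase a Hölder constant. For points in different cells
this is Jensen's inequality, since the increment of the interpolation is an average of increments
between nodes, and the distance is the same average of the distances. -/
theorem norm_linInterp_sub_le (hβ0 : 0 < β) (hβ1 : β ≤ 1) {h K δ : ℝ} (hh : 0 < h) (hK : 0 ≤ K)
    {F : ℝ → 𝕜} (hF : ∀ s t, |t - s| ≤ δ → ‖F t - F s‖ ≤ K * |t - s| ^ β) {x y : ℝ} (hxy : x ≤ y)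
    (hδ : ((⌈y / h⌉ : ℝ) - ⌈x / h⌉ + 1) * h ≤ δ) :
    ‖linInterp h F y - linInterp h F x‖ ≤ K * (y - x) ^ β := by
  set k := ⌈x / h⌉ with hk
  set l := ⌈y / h⌉ with hl
  have hkl : k ≤ l := Int.ceil_le_ceil (by gcongr)
  have hη := ceil_sub_mem_Icc (x / h)
  have hθ := ceil_sub_mem_Icc (y / h)
  rw [← hk] at hη
  rw [← hl] at hθ
  rcases hkl.eq_or_lt with he | hlt
  -- In a single cell the interpolation is affine, and `d ≤ d^β` for `d = (y - x)/h ∈ [0, 1]`.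
  · set d := (y - x) / h with hd
    have hd0 : 0 ≤ d := div_nonneg (by linarith) hh.le
    have hd' : d = (k - x / h) - (l - y / h) := by rw [hd, he]; field_simp; ring
    have hd1 : d ≤ 1 := by rw [hd']; linarith [hη.2, hθ.1]
    have e : linInterp h F y - linInterp h F x = d • (F (k * h) - F ((k - 1) * h)) := by
      rw [linInterp, linInterp, ← hk, ← hl, hd', ← he]
      simp only [smul_sub, sub_smul, one_smul]; abel
    have hdist : |(k : ℝ) * h - (k - 1) * h| = h := by
      rw [show (k : ℝ) * h - (k - 1) * h = h by ring, abs_of_pos hh]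
    have h1 := hF ((k - 1) * h) (k * h) (by
      rw [hdist]
      refine le_trans ?_ hδ
      rw [he, sub_self, zero_add, one_mul])
    rw [hdist] at h1
    have hyx : y - x = d * h := by rw [hd]; field_simp
    rw [e, norm_smul, Real.norm_of_nonneg hd0, hyx, Real.mul_rpow hd0 hh.le]
    have h2 : d ≤ d ^ β := by
      rcases hd0.eq_or_lt with h0 | h0
      · rw [← h0]; positivity
      · simpa using Real.rpow_le_rpow_of_exponent_ge h0 hd1 hβ1
    calc d * ‖F (k * h) - F ((k - 1) * h)‖ ≤ d ^ β * (K * h ^ β) := by gcongr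
      _ = K * (d ^ β * h ^ β) := by ring
  · have hlt' : (k : ℝ) + 1 ≤ l := by exact_mod_cast hlt
    have hprod : ((k : ℝ) + 1) * h ≤ l * h := by gcongr
    have hpair : ∀ p q : ℝ, (k : ℝ) * h ≤ p → p ≤ l * h → (k - 1) * h ≤ q → q ≤ k * h →
        ‖F q - F p‖ ≤ K * (p - q) ^ β := fun p q h1 h2 h3 h4 => by
      have := hF p q (by
        rw [abs_sub_comm, abs_of_nonneg (by linarith)]
        refine le_trans ?_ hδ
        linarith)
      rwa [abs_sub_comm, abs_of_nonneg (by linarith)] at this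
    have hx' : ∀ p : ℝ, (k : ℝ) * h ≤ p → p ≤ l * h →
        ‖F p - linInterp h F x‖ ≤ K * (p - x) ^ β := fun p h1 h2 => by
      have := norm_convexComb_sub_le hβ0 hβ1 (a := p - k * h) (b := p - (k - 1) * h) hK
        (by linarith) (by linarith) hη
        (hpair p (k * h) h1 h2 (by linarith) le_rfl)
        (hpair p ((k - 1) * h) h1 h2 le_rfl (by linarith))
      rw [norm_sub_rev]
      refine this.trans (le_of_eq ?_)
      congr 2
      field_simp
      ring
    have hkx : x ≤ k * h := by
      have := Int.le_ceil (x / h)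
      rwa [← hk, div_le_iff₀ hh] at this
    have := norm_convexComb_sub_le hβ0 hβ1 (a := l * h - x) (b := (l - 1) * h - x) hK
      (by linarith) (by linarith) hθ
      (hx' (l * h) (by linarith) le_rfl) (hx' ((l - 1) * h) (by linarith) (by linarith))
    refine this.trans (le_of_eq ?_)
    congr 2
    field_simp
    ring

/-- Polygonal interpolation as a contraction on `H^β`. -/
def interpOp (hβ0 : 0 < β) (hβ1 : β ≤ 1) {h : ℝ} (hh : 0 < h) :
    Holder β 𝕜 →L[ℝ] Holder β 𝕜 :=
  Holder.mkOp
    { toFun := fun g x => linInterp h (extend g) x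
      map_add' := fun f g => funext fun x => congrFun (linInterp_add h (extend f) (extend g)) x
      map_smul' := fun c g => funext fun x => congrFun (linInterp_smul h c (extend g)) x }
    1 (fun g => linInterp_of_nonpos hh (fun _ => extend_of_nonpos g) le_rfl) zero_le_one
    (by
      have key : ∀ (g : Holder β 𝕜) (x y : ℝ), x ≤ y →
          ‖linInterp h (extend g) y - linInterp h (extend g) x‖ ≤ ‖g‖ * (y - x) ^ β :=
        fun g x y hxy => norm_linInterp_sub_le hβ0 hβ1 hh (norm_nonneg g)
          (fun s t _ => norm_extend_sub_le hβ0 g s t) hxy le_rfl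
      intro g s t
      rw [one_mul]
      rcases le_total (s : ℝ) t with hst | hst
      · rw [abs_of_nonneg (by linarith)]; exact key g s t hst
      · rw [abs_sub_comm, abs_of_nonneg (by linarith), norm_sub_rev]; exact key g t s hst)

theorem interpOp_apply (hβ0 : 0 < β) (hβ1 : β ≤ 1) {h : ℝ} (hh : 0 < h) (g : Holder β 𝕜)
    (x : unitInterval) : interpOp hβ0 hβ1 hh g x = linInterp h (extend g) x := rfl

theorem extend_interpOp (hβ0 : 0 < β) (hβ1 : β ≤ 1) {h : ℝ} (hh : 0 < h) (g : Holder β 𝕜)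
    {x : ℝ} (hx : x ≤ 1) : extend (interpOp hβ0 hβ1 hh g) x = linInterp h (extend g) x :=
  extend_eq_of_le_one (g := interpOp hβ0 hβ1 hh g)
    (fun _ hy => linInterp_of_nonpos hh (fun _ => extend_of_nonpos g) hy) (fun _ => rfl) hx

theorem interpOp_mul_self (hβ0 : 0 < β) (hβ1 : β ≤ 1) {n : ℕ} {h : ℝ} (hh : 0 < h)
    (hnh : n * h = 1) : (interpOp hβ0 hβ1 hh : Holder β 𝕜 →L[ℝ] Holder β 𝕜) *
      interpOp hβ0 hβ1 hh = interpOp hβ0 hβ1 hh := by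
  ext g x
  rw [mul_apply_eq_comp, interpOp_apply,
    linInterp_congr hh hnh (fun y hy => extend_interpOp hβ0 hβ1 hh g hy) x.2.2, interpOp_apply]
  have h1 := linInterp_int_mul hh (extend g) ⌈(x : ℝ) / h⌉
  have h2 := linInterp_int_mul hh (extend g) (⌈(x : ℝ) / h⌉ - 1)
  push_cast at h2
  rw [linInterp, h1, h2]
  rfl

theorem commute_shift_interpOp (hβ0 : 0 < β) (hβ1 : β ≤ 1) {n : ℕ} {h : ℝ} (hh : 0 < h)
    (hnh : n * h = 1) :
    Commute (shift hβ0 hh.le : Holder β 𝕜 →L[ℝ] Holder β 𝕜) (interpOp hβ0 hβ1 hh) := by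
  ext g x
  rw [mul_apply_eq_comp, mul_apply_eq_comp, interpOp_apply, shift_apply,
    extend_interpOp _ _ _ _ (by linarith [x.2.2]),
    linInterp_congr hh hnh (fun y hy => extend_shift hβ0 hh.le g hy) x.2.2,
    linInterp_comp_sub hh]

theorem nabla_extend {h : ℝ} (f : Holder β 𝕜) (y : ℝ) :
    nabla h (extend f) y = h⁻¹ • (extend f y - extend f (y - h)) := by
  rw [nabla]
  split_ifs with hy
  · rfl
  · rw [extend_of_nonpos f (by linarith : y - h ≤ 0), sub_zero]

theorem extNabla_apply (hβ1 : β ≤ 1) {n : ℕ} {h : ℝ} (hn : 1 ≤ n) (hhn : h = 1 / n)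
    (f : Holder β 𝕜) (x : unitInterval) :
    extNabla hβ1 n f x = linInterp h (nabla h (extend f)) x := by
  have hn' : (0 : ℝ) < n := by exact_mod_cast hn
  subst hhn
  exact interp_eq_linInterp (by positivity) (by field_simp) (nabla_extend_zero n f) x

/-- `A_h = h⁻¹ (1 - T_h) I_h`, where `T_h` is the translation by `h` and `I_h` the polygonal
interpolation. -/
theorem extNabla_eq (hβ0 : 0 < β) (hβ1 : β ≤ 1) {n : ℕ} {h : ℝ} (hn : 1 ≤ n) (hh : 0 < h)
    (hhn : h = 1 / n) (f : Holder β 𝕜) :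
    extNabla hβ1 n f =
      (h⁻¹ • ((1 - shift hβ0 hh.le) * interpOp hβ0 hβ1 hh) : Holder β 𝕜 →L[ℝ] Holder β 𝕜) f := by
  have hnab : nabla h (extend f) = h⁻¹ • (extend f + (-1 : ℝ) • fun y => extend f (y - h)) := by
    funext y
    rw [nabla_extend]
    simp [sub_eq_add_neg]
  ext x
  rw [extNabla_apply hβ1 hn hhn, hnab, linInterp_smul, linInterp_add, linInterp_smul]
  simp only [Pi.smul_apply, Pi.add_apply]
  rw [linInterp_comp_sub hh]
  simp only [smul_apply, Holder.smul_apply, mul_apply_eq_comp, sub_apply, one_apply_eq_self,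
    Holder.sub_apply, shift_apply, interpOp_apply]
  rw [extend_interpOp _ _ _ _ (by linarith [x.2.2])]
  simp [sub_eq_add_neg]

/-! ### Resolvents and the discrete fractional power -/

theorem IsResolvent.eq {Z : Type*} [NormedAddCommGroup Z] [NormedSpace ℝ Z] {B : Z →ₗ.[ℝ] Z}
    {l : ℝ} {R R' : Z →L[ℝ] Z} (h : IsResolvent B l R) (h' : IsResolvent B l R') : R = R' := by
  ext g
  obtain ⟨hg, e⟩ := h.1 g
  have := h'.2 ⟨R g, hg⟩
  rw [e] at this
  exact this.symm

theorem resolventNeg_eq {Z : Type*} [NormedAddCommGroup Z] [NormedSpace ℝ Z] {B : Z →ₗ.[ℝ] Z}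
    {l : ℝ} {R : Z →L[ℝ] Z} (h : IsResolvent B l R) : resolventNeg B l = R := by
  have hex : ∃ R : Z →L[ℝ] Z, IsResolvent B l R := ⟨R, h⟩
  rw [resolventNeg, dif_pos hex]
  exact hex.choose_spec.eq h

/-- The resolvent of `B = h⁻¹ (1 - S) P` for a projection `P` commuting with a nilpotent `S`:
`B` vanishes on the kernel of `P`, and on the range of `P` the inverse of
`l + h⁻¹ (1 - S)` is a finite Neumann series. -/
theorem mul_neumann_projection_eq_one {A : Type*} [Ring A] [Algebra ℝ A] {S P : A} {n : ℕ}
    {l h : ℝ} (hl : 0 < l) (hh : 0 < h) (hSP : Commute S P) (hP : P * P = P) (hS : S ^ n = 0) :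
    (l • 1 + h⁻¹ • ((1 - S) * P)) * (l⁻¹ • (1 - P) +
        (∑ m ∈ Finset.range n, (h * ((1 + l * h)⁻¹) ^ (m + 1)) • S ^ m) * P) = 1 ∧
      (l⁻¹ • (1 - P) + (∑ m ∈ Finset.range n, (h * ((1 + l * h)⁻¹) ^ (m + 1)) • S ^ m) * P) *
        (l • 1 + h⁻¹ • ((1 - S) * P)) = 1 := by
  set a : ℝ := (1 + l * h)⁻¹ with ha
  set W : A := ∑ m ∈ Finset.range n, (h * a ^ (m + 1)) • S ^ m with hW
  have ha0 : a ≠ 0 := by positivity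
  have hW' : W = (h * a) • ∑ m ∈ Finset.range n, (a • S) ^ m := by
    rw [hW, Finset.smul_sum]
    refine Finset.sum_congr rfl fun m _ => ?_
    rw [smul_pow, smul_smul, pow_succ]
    congr 1; ring
  have hcoef : l • (1 : A) + h⁻¹ • (1 - S) = (h⁻¹ * a⁻¹) • (1 - a • S) := by
    have : h⁻¹ * a⁻¹ = l + h⁻¹ := by rw [ha]; field_simp; ring
    rw [smul_sub, smul_sub, smul_smul, mul_assoc, inv_mul_cancel₀ ha0, mul_one, this, add_smul,
      add_sub_assoc]
  have hW1 : (l • (1 : A) + h⁻¹ • (1 - S)) * W = 1 := by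
    rw [hcoef, hW', smul_mul_smul_comm, mul_neg_geom_sum, smul_pow, hS, smul_zero, sub_zero]
    rw [show h⁻¹ * a⁻¹ * (h * a) = 1 by field_simp, one_smul]
  have hWP : Commute W P := by
    rw [hW]
    exact Commute.sum_left _ _ _ fun m _ => (hSP.pow_left m).smul_left _
  have hWS : Commute W S := by
    rw [hW]
    exact Commute.sum_left _ _ _ fun m _ => ((Commute.refl S).pow_left m).smul_left _
  have hPP : P * (1 - P) = 0 := by rw [mul_sub, mul_one, hP, sub_self]
  have h1 : (l • 1 + h⁻¹ • ((1 - S) * P)) * (l⁻¹ • (1 - P) + W * P) = 1 := by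
    have e1 : (l • (1 : A)) * (l⁻¹ • (1 - P)) = 1 - P := by
      rw [smul_mul_smul_comm, mul_inv_cancel₀ hl.ne', one_smul, one_mul]
    have e2 : (h⁻¹ • ((1 - S) * P)) * (l⁻¹ • (1 - P)) = 0 := by
      rw [smul_mul_smul_comm, mul_assoc, hPP, mul_zero, smul_zero]
    have e3 : (h⁻¹ • ((1 - S) * P)) * (W * P) = (h⁻¹ • (1 - S)) * W * P := by
      rw [hWP.eq, smul_mul_assoc, mul_assoc, ← mul_assoc P P W, hP, ← hWP.eq, smul_mul_assoc,
        smul_mul_assoc, mul_assoc]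
    rw [add_mul, mul_add, mul_add, e1, e2, e3, zero_add, add_assoc, ← mul_assoc, ← add_mul,
      ← add_mul, hW1, one_mul, sub_add_cancel]
  refine ⟨h1, ?_⟩
  have c1 : Commute (l⁻¹ • (1 - P) + W * P) ((1 - S) * P) := by
    have hP1 : Commute (1 - P) P := (Commute.one_left P).sub_left (Commute.refl P)
    have hPS : Commute (1 - P) (1 - S) :=
      ((Commute.one_right _).sub_right ((Commute.one_left S).sub_left hSP.symm))
    have hW2 : Commute (W * P) (1 - S) :=
      ((Commute.one_right _).sub_right (hWS.mul_left hSP.symm))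
    exact ((hPS.mul_right hP1).smul_left _).add_left
      (hW2.mul_right (hWP.mul_left (Commute.refl P)))
  have c : Commute (l⁻¹ • (1 - P) + W * P) (l • 1 + h⁻¹ • ((1 - S) * P)) :=
    ((Commute.one_right _).smul_right _).add_right (c1.smul_right _)
  rw [c.eq, h1]

/-- `(l + A_h)⁻¹ = l⁻¹ (1 - I_h) + ∑_{m<n} h (1+lh)^{-(m+1)} T_h^m I_h`. -/
def nablaResolvent (hβ0 : 0 < β) (hβ1 : β ≤ 1) {h : ℝ} (hh : 0 < h) (n : ℕ) (l : ℝ) :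
    Holder β 𝕜 →L[ℝ] Holder β 𝕜 :=
  l⁻¹ • (1 - interpOp hβ0 hβ1 hh) +
    (∑ m ∈ Finset.range n, (h * ((1 + l * h)⁻¹) ^ (m + 1)) • shift hβ0 hh.le ^ m) *
      interpOp hβ0 hβ1 hh

theorem isResolvent_nablaResolvent (hβ0 : 0 < β) (hβ1 : β ≤ 1) {n : ℕ} {h l : ℝ} (hn : 1 ≤ n)
    (hh : 0 < h) (hhn : h = 1 / n) (hl : 0 < l) :
    IsResolvent (extNablaOp (𝕜 := 𝕜) hβ1 n) l (nablaResolvent hβ0 hβ1 hh n l) := by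
  have hnh : n * h = 1 := by
    have : (n : ℝ) ≠ 0 := by positivity
    rw [hhn]; field_simp
  obtain ⟨h1, h2⟩ := mul_neumann_projection_eq_one hl hh
    (commute_shift_interpOp (𝕜 := 𝕜) hβ0 hβ1 hh hnh) (interpOp_mul_self hβ0 hβ1 hh hnh)
    (shift_pow_eq_zero hβ0 hh.le hnh.ge)
  refine ⟨fun g => ⟨Submodule.mem_top, ?_⟩, fun u => ?_⟩
  · have := congrArg (fun T : Holder β 𝕜 →L[ℝ] Holder β 𝕜 => T g) h1
    simp only [mul_apply_eq_comp, add_apply, smul_apply, one_apply_eq_self] at this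
    rw [show (extNablaOp hβ1 n ⟨nablaResolvent hβ0 hβ1 hh n l g, Submodule.mem_top⟩ :
      Holder β 𝕜) = extNabla hβ1 n (nablaResolvent hβ0 hβ1 hh n l g) from rfl,
      extNabla_eq hβ0 hβ1 hn hh hhn]
    exact this
  · have := congrArg (fun T : Holder β 𝕜 →L[ℝ] Holder β 𝕜 => T (u : Holder β 𝕜)) h2
    simp only [mul_apply_eq_comp, add_apply, smul_apply, one_apply_eq_self] at this
    rw [show (extNablaOp hβ1 n u : Holder β 𝕜) = extNabla hβ1 n u from rfl,
      extNabla_eq hβ0 hβ1 hn hh hhn]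
    exact this

theorem interpOp_extNabla (hβ0 : 0 < β) (hβ1 : β ≤ 1) {n : ℕ} {h : ℝ} (hn : 1 ≤ n)
    (hh : 0 < h) (hhn : h = 1 / n) (f : Holder β 𝕜) :
    interpOp hβ0 hβ1 hh (extNabla hβ1 n f) = extNabla hβ1 n f := by
  have hnh : n * h = 1 := by
    have : (n : ℝ) ≠ 0 := by positivity
    rw [hhn]; field_simp
  have hc := commute_shift_interpOp (𝕜 := 𝕜) hβ0 hβ1 hh hnh
  have hP := interpOp_mul_self (𝕜 := 𝕜) hβ0 hβ1 hh hnh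
  have hc' : Commute (1 - shift hβ0 hh.le : Holder β 𝕜 →L[ℝ] Holder β 𝕜)
    (interpOp hβ0 hβ1 hh) := (Commute.one_left _).sub_left hc
  rw [extNabla_eq hβ0 hβ1 hn hh hhn, ← mul_apply_eq_comp, mul_smul_comm, ← mul_assoc, ← hc'.eq,
    mul_assoc, hP]

/-- The Balakrishnan integrand of `A_h` is a finite sum of scalar functions times vectors. -/
theorem smul_resolventNeg_extNablaOp (hβ0 : 0 < β) (hβ1 : β ≤ 1) {n : ℕ} {h : ℝ} (hn : 1 ≤ n)
    (hh : 0 < h) (hhn : h = 1 / n) (α : ℝ) (f : Holder β 𝕜) {l : ℝ} (hl : 0 < l) :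
    l ^ (α - 1) • resolventNeg (extNablaOp hβ1 n) l
        (extNablaOp hβ1 n ⟨f, Submodule.mem_top⟩) =
      ∑ m ∈ Finset.range n, (h * (l ^ (α - 1) * ((1 + l * h)⁻¹) ^ (m + 1))) •
        (shift hβ0 hh.le ^ m) (extNabla hβ1 n f) := by
  rw [resolventNeg_eq (isResolvent_nablaResolvent hβ0 hβ1 hn hh hhn hl),
    show (extNablaOp hβ1 n ⟨f, Submodule.mem_top⟩ : Holder β 𝕜) = extNabla hβ1 n f from rfl,
    nablaResolvent, add_apply, smul_apply, sub_apply, one_apply_eq_self, mul_apply_eq_comp,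
    interpOp_extNabla hβ0 hβ1 hn hh hhn, sub_self, smul_zero, zero_add,
    sum_apply, Finset.smul_sum]
  refine Finset.sum_congr rfl fun m _ => ?_
  rw [smul_apply, smul_smul]
  congr 1; ring

theorem hasFracPow_extNablaOp (hβ0 : 0 < β) (hβ1 : β ≤ 1) {α : ℝ} (hα0 : 0 < α) (hα1 : α < 1)
    {n : ℕ} (hn : 1 ≤ n) (f : Holder β 𝕜) :
    HasFracPow (extNablaOp (𝕜 := 𝕜) hβ1 n) α ⟨f, Submodule.mem_top⟩ := by
  have hh : (0 : ℝ) < 1 / n := by positivity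
  refine ⟨fun l hl => ⟨_, isResolvent_nablaResolvent hβ0 hβ1 hn hh rfl hl⟩, ?_⟩
  refine IntegrableOn.congr_fun ?_ (fun l hl =>
    (smul_resolventNeg_extNablaOp hβ0 hβ1 hn hh rfl α f hl).symm) measurableSet_Ioi
  exact integrable_finsetSum _ fun m _ =>
    ((integral_rpow_mul_inv_one_add_pow hα0 hα1 hh m).1.const_mul _).smul_const _

theorem fracExtNabla_eq (hβ0 : 0 < β) (hβ1 : β ≤ 1) {α : ℝ} (hα0 : 0 < α) (hα1 : α < 1)
    {n : ℕ} {h : ℝ} (hn : 1 ≤ n) (hh : 0 < h) (hhn : h = 1 / n) (f : Holder β 𝕜) :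
    fracExtNabla hβ1 α n f = (Real.Gamma (1 - α))⁻¹ • ∑ m ∈ Finset.range n,
      (h ^ (1 - α) * (Real.Gamma (m + (1 - α)) / Real.Gamma (m + 1))) •
        (shift hβ0 hh.le ^ m) (extNabla hβ1 n f) := by
  rw [fracExtNabla, fracPow, setIntegral_congr_fun measurableSet_Ioi fun l hl =>
    smul_resolventNeg_extNablaOp hβ0 hβ1 hn hh hhn α f hl, integral_finsetSum]
  · rw [← sin_div_pi_mul_Gamma hα0 hα1, mul_smul, Finset.smul_sum (r := Real.Gamma α)]
    congr 1
    refine Finset.sum_congr rfl fun m _ => ?_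
    rw [integral_smul_const, integral_const_mul, (integral_rpow_mul_inv_one_add_pow hα0 hα1 hh m).2,
      smul_smul, sub_eq_add_neg 1 α, Real.rpow_add hh, Real.rpow_one]
    congr 1; ring
  · exact fun m _ =>
      ((integral_rpow_mul_inv_one_add_pow hα0 hα1 hh m).1.const_mul _).smul_const _

/-! ### Averages of translations and the resolvent of the derivative -/

theorem intervalIntegrable_smul_extend (hβ0 : 0 < β) {φ : ℝ → ℝ} {a b : ℝ}
    (hφ : IntervalIntegrable φ volume a b) (g : Holder β 𝕜) (x : ℝ) :
    IntervalIntegrable (fun s => φ s • extend g (x - s)) volume a b :=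
  hφ.smul_continuousOn
    ((continuous_extend hβ0 g).comp (continuous_const.sub continuous_id)).continuousOn

/-- The operator `g ↦ ∫_0^1 φ(s) g(· - s) ds`. It is defined by pointwise integrals, as
`s ↦ g(· - s)` need not be measurable with values in `H^β`. -/
def kernelOp (hβ0 : 0 < β) {φ : ℝ → ℝ} (hφ : IntervalIntegrable φ volume 0 1) :
    Holder β 𝕜 →L[ℝ] Holder β 𝕜 :=
  Holder.mkOp
    { toFun := fun g x => ∫ s in (0 : ℝ)..1, φ s • extend g ((x : ℝ) - s)
      map_add' := fun f g => funext fun x => by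
        rw [Pi.add_apply, ← intervalIntegral.integral_add
          (intervalIntegrable_smul_extend hβ0 hφ f x) (intervalIntegrable_smul_extend hβ0 hφ g x)]
        simp only [← smul_add]
        rfl
      map_smul' := fun c g => funext fun x => by
        rw [Pi.smul_apply, RingHom.id_apply, ← intervalIntegral.integral_smul]
        simp only [smul_comm c]
        rfl }
    (∫ s in (0 : ℝ)..1, |φ s|)
    (fun g => by
      refine (intervalIntegral.integral_congr (g := fun _ => (0 : 𝕜)) fun s hs => ?_).trans
        intervalIntegral.integral_zero
      rw [uIcc_of_le zero_le_one] at hs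
      simp only
      rw [extend_of_nonpos g (by simpa using hs.1), smul_zero])
    (intervalIntegral.integral_nonneg zero_le_one fun _ _ => abs_nonneg _)
    (fun g s t => by
      change ‖(∫ r in (0 : ℝ)..1, φ r • extend g ((t : ℝ) - r)) -
        ∫ r in (0 : ℝ)..1, φ r • extend g ((s : ℝ) - r)‖ ≤ _
      rw [← intervalIntegral.integral_sub (intervalIntegrable_smul_extend hβ0 hφ g t)
        (intervalIntegrable_smul_extend hβ0 hφ g s), mul_assoc,
        ← intervalIntegral.integral_mul_const]
      refine intervalIntegral.norm_integral_le_of_norm_le zero_le_one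
        (ae_of_all _ fun r _ => ?_) (hφ.abs.mul_const _)
      rw [← smul_sub, norm_smul, Real.norm_eq_abs]
      have := norm_extend_sub_le hβ0 g ((s : ℝ) - r) ((t : ℝ) - r)
      rw [sub_sub_sub_cancel_right] at this
      gcongr)

theorem kernelOp_apply (hβ0 : 0 < β) {φ : ℝ → ℝ} (hφ : IntervalIntegrable φ volume 0 1)
    (g : Holder β 𝕜) (x : unitInterval) :
    kernelOp hβ0 hφ g x = ∫ s in (0 : ℝ)..1, φ s • extend g ((x : ℝ) - s) := rfl

theorem norm_kernelOp_apply_le (hβ0 : 0 < β) {φ : ℝ → ℝ} (hφ : IntervalIntegrable φ volume 0 1)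
    (g : Holder β 𝕜) : ‖kernelOp hβ0 hφ g‖ ≤ (∫ s in (0 : ℝ)..1, |φ s|) * ‖g‖ :=
  Holder.norm_mkOp_apply_le _ _ _ _ _ g

theorem intervalIntegrable_exp_neg_mul (l a b : ℝ) :
    IntervalIntegrable (fun s : ℝ => Real.exp (-(l * s))) volume a b :=
  (by fun_prop : Continuous fun s : ℝ => Real.exp (-(l * s))).intervalIntegrable _ _

/-- `(l + A)⁻¹ g = ∫_0^1 e^{-ls} g(· - s) ds`. -/
def derivResolvent (hβ0 : 0 < β) (l : ℝ) : Holder β 𝕜 →L[ℝ] Holder β 𝕜 :=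
  kernelOp hβ0 (intervalIntegrable_exp_neg_mul l 0 1)

/-- Variation of constants. -/
theorem derivResolvent_apply (hβ0 : 0 < β) (l : ℝ) (g : Holder β 𝕜) (x : unitInterval) :
    derivResolvent hβ0 l g x =
      Real.exp (-(l * x)) • ∫ s in (0 : ℝ)..x, Real.exp (l * s) • extend g s := by
  have hcont := continuous_extend hβ0 g
  have e1 : ∀ s : ℝ, Real.exp (-(l * s)) • extend g ((x : ℝ) - s) =
      (fun u : ℝ => Real.exp (-(l * ((x : ℝ) - u))) • extend g u) ((x : ℝ) - s) := fun s => by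
    simp only [sub_sub_cancel]
  have hint : ∀ a b : ℝ, IntervalIntegrable
      (fun u : ℝ => Real.exp (-(l * ((x : ℝ) - u))) • extend g u) volume a b := fun a b =>
    Continuous.intervalIntegrable (by fun_prop) _ _
  have hzero : ∫ u in (x : ℝ) - 1..0, Real.exp (-(l * ((x : ℝ) - u))) • extend g u = 0 := by
    refine (intervalIntegral.integral_congr (g := fun _ => (0 : 𝕜)) fun s hs => ?_).trans
        intervalIntegral.integral_zero
    rw [uIcc_of_le (by linarith [x.2.2])] at hs
    simp only
    rw [extend_of_nonpos g hs.2, smul_zero]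
  rw [derivResolvent, kernelOp_apply]
  simp only [e1]
  rw [intervalIntegral.integral_comp_sub_left
    (fun u : ℝ => Real.exp (-(l * ((x : ℝ) - u))) • extend g u), sub_zero,
    ← intervalIntegral.integral_add_adjacent_intervals (hint _ 0) (hint 0 _), hzero, zero_add,
    ← intervalIntegral.integral_smul]
  simp only [smul_smul, ← Real.exp_add]
  ring_nf

theorem hasDerivWithinAt_derivResolvent (hβ0 : 0 < β) (l : ℝ) (g : Holder β 𝕜)
    (x : unitInterval) :
    HasDerivWithinAt (extend (derivResolvent hβ0 l g)) (g x - l • derivResolvent hβ0 l g x)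
      (Icc 0 1) x := by
  have hcont := continuous_extend hβ0 g
  have hI : HasDerivAt (fun y : ℝ => ∫ s in (0 : ℝ)..y, Real.exp (l * s) • extend g s)
      (Real.exp (l * x) • extend g x) x :=
    intervalIntegral.integral_hasDerivAt_right
      (Continuous.intervalIntegrable (by fun_prop) _ _)
      (Continuous.stronglyMeasurableAtFilter (by fun_prop) _ _)
      (Continuous.continuousAt (by fun_prop))
  have hE : HasDerivAt (fun y : ℝ => Real.exp (-(l * y))) (Real.exp (-(l * x)) * (-l)) x := by
    have := ((hasDerivAt_id (x : ℝ)).const_mul l).neg.exp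
    simpa using this
  have hΨ := (hE.smul hI).hasDerivWithinAt (s := Icc (0 : ℝ) 1)
  have heq : ∀ y ∈ Icc (0 : ℝ) 1, extend (derivResolvent hβ0 l g) y =
      Real.exp (-(l * y)) • ∫ s in (0 : ℝ)..y, Real.exp (l * s) • extend g s := fun y hy => by
    rw [← derivResolvent_apply hβ0 l g ⟨y, hy⟩]
    exact extend_apply_coe _ ⟨y, hy⟩
  refine (hΨ.congr heq (heq x x.2)).congr_deriv ?_
  rw [derivResolvent_apply, extend_apply_coe, smul_smul, ← Real.exp_add, neg_add_cancel,
    Real.exp_zero, one_smul, mul_comm, mul_smul, neg_smul, sub_eq_add_neg]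

theorem derivOp_apply (u : (derivOp β 𝕜).domain) (x : unitInterval) :
    derivOp β 𝕜 u x = derivWithin (extend u.1) (Icc 0 1) x := rfl

theorem hasDerivWithinAt_derivOp (u : (derivOp β 𝕜).domain) (x : unitInterval) :
    HasDerivWithinAt (extend u.1) (derivOp β 𝕜 u x) (Icc 0 1) x :=
  (u.2.1 x).hasDerivWithinAt

theorem continuousOn_extend_domain (u : (derivOp β 𝕜).domain) :
    ContinuousOn (extend u.1) (Icc 0 1) := fun x hx =>
  (u.2.1 ⟨x, hx⟩).continuousWithinAt

theorem hasDerivAt_extend_domain (u : (derivOp β 𝕜).domain) {x : ℝ} (hx : x ∈ Ioo (0 : ℝ) 1) :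
    HasDerivAt (extend u.1) (extend (derivOp β 𝕜 u) x) x := by
  have hm : x ∈ Icc (0 : ℝ) 1 := Ioo_subset_Icc_self hx
  have := (hasDerivWithinAt_derivOp u ⟨x, hm⟩).hasDerivAt (Icc_mem_nhds hx.1 hx.2)
  rwa [← extend_apply_coe (derivOp β 𝕜 u) ⟨x, hm⟩] at this

theorem isResolvent_derivResolvent (hβ0 : 0 < β) (l : ℝ) :
    IsResolvent (derivOp β 𝕜) l (derivResolvent hβ0 l) := by
  have hder : ∀ (g : Holder β 𝕜) (x : unitInterval),
      derivWithin (extend (derivResolvent hβ0 l g)) (Icc 0 1) x =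
        (g - l • derivResolvent hβ0 l g) x := fun g x =>
    (hasDerivWithinAt_derivResolvent hβ0 l g x).derivWithin
      (uniqueDiffOn_Icc zero_lt_one x x.2)
  refine ⟨fun g => ?_, fun u => ?_⟩
  · have hg : derivResolvent hβ0 l g ∈ (derivOp β 𝕜).domain := by
      refine ⟨fun x => (hasDerivWithinAt_derivResolvent hβ0 l g x).differentiableWithinAt, ?_⟩
      rw [funext (hder g)]
      exact (g - l • derivResolvent hβ0 l g).2
    refine ⟨hg, Holder.ext fun x => ?_⟩
    rw [Holder.add_apply, derivOp_apply, hder, Holder.sub_apply, add_sub_cancel]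
  · set g : Holder β 𝕜 := l • (u : Holder β 𝕜) + derivOp β 𝕜 u with hg
    ext x
    have hF : ∀ s ∈ Ioo (0 : ℝ) x, HasDerivAt (fun s : ℝ => Real.exp (l * s) • extend u.1 s)
        (Real.exp (l * s) • extend g s) s := fun s hs => by
      have h1 := hasDerivAt_extend_domain u (x := s) ⟨hs.1, hs.2.trans_le x.2.2⟩
      have hE : HasDerivAt (fun y : ℝ => Real.exp (l * y)) (Real.exp (l * s) * l) s := by
        simpa using ((hasDerivAt_id s).const_mul l).exp
      have h2 : extend g s = l • extend u.1 s + extend (derivOp β 𝕜 u) s := rfl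
      refine (hE.smul h1).congr_deriv ?_
      rw [h2, smul_add, mul_smul, add_comm]
    have hcont := continuous_extend hβ0 g
    have hFTC : ∫ s in (0 : ℝ)..x, Real.exp (l * s) • extend g s =
        Real.exp (l * x) • extend u.1 x - Real.exp (l * 0) • extend u.1 0 :=
      intervalIntegral.integral_eq_sub_of_hasDerivAt_of_le x.2.1
        (ContinuousOn.fun_smul (by fun_prop)
          ((continuousOn_extend_domain u).mono (Icc_subset_Icc_right x.2.2))) hF
        (Continuous.intervalIntegrable (by fun_prop) _ _)
    rw [derivResolvent_apply, hFTC, extend_of_nonpos u.1 le_rfl, smul_zero, sub_zero, smul_smul,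
      ← Real.exp_add, neg_add_cancel, Real.exp_zero, one_smul, extend_apply_coe]

/-! ### The fractional derivative -/

theorem norm_derivResolvent_apply_le (hβ0 : 0 < β) (l : ℝ) (g : Holder β 𝕜) :
    ‖derivResolvent hβ0 l g‖ ≤ (∫ s in (0 : ℝ)..1, Real.exp (-(l * s))) * ‖g‖ := by
  have := norm_kernelOp_apply_le hβ0 (intervalIntegrable_exp_neg_mul l 0 1) g
  simp only [abs_of_pos (Real.exp_pos _)] at this
  exact this

/-- On `l > 0` the resolvent is Lipschitz continuous in `l`, as `e^{-ls}` is for `s ∈ [0,1]`. -/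
theorem continuousOn_derivResolvent_apply (hβ0 : 0 < β) (g : Holder β 𝕜) :
    ContinuousOn (fun l : ℝ => derivResolvent hβ0 l g) (Ioi 0) := by
  have key : ∀ l ∈ Ioi (0 : ℝ), ∀ m ∈ Ioi (0 : ℝ),
      dist (derivResolvent hβ0 l g) (derivResolvent hβ0 m g) ≤ ‖g‖ * dist l m := by
    intro l hl m hm
    have hint := (intervalIntegrable_exp_neg_mul l 0 1).sub (intervalIntegrable_exp_neg_mul m 0 1)
    have e : derivResolvent hβ0 l g - derivResolvent hβ0 m g = kernelOp hβ0 hint g := by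
      ext x
      rw [Holder.sub_apply, derivResolvent, derivResolvent, kernelOp_apply, kernelOp_apply,
        kernelOp_apply, ← intervalIntegral.integral_sub
          (intervalIntegrable_smul_extend hβ0 (intervalIntegrable_exp_neg_mul l 0 1) g x)
          (intervalIntegrable_smul_extend hβ0 (intervalIntegrable_exp_neg_mul m 0 1) g x)]
      simp only [← sub_smul]
    have hexp : ∀ a b : ℝ, 0 ≤ a → 0 ≤ b → |Real.exp (-a) - Real.exp (-b)| ≤ |a - b| := by
      have h1 : ∀ a b : ℝ, 0 ≤ a → a ≤ b → Real.exp (-a) - Real.exp (-b) ≤ b - a := by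
        intro a b ha hab
        have h2 := Real.add_one_le_exp (a - b)
        have h3 : Real.exp (-b) = Real.exp (-a) * Real.exp (a - b) := by
          rw [← Real.exp_add]; ring_nf
        have h4 : Real.exp (-a) ≤ 1 := Real.exp_le_one_iff.2 (by linarith)
        have h5 := Real.exp_pos (-a)
        rw [h3]
        nlinarith
      intro a b ha hb
      rcases le_total a b with hab | hab
      · rw [abs_of_nonneg (sub_nonneg.2 (Real.exp_le_exp.2 (by linarith))), abs_sub_comm,
          abs_of_nonneg (by linarith)]
        exact h1 a b ha hab
      · rw [abs_sub_comm, abs_of_nonneg (sub_nonneg.2 (Real.exp_le_exp.2 (by linarith))),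
          abs_of_nonneg (by linarith)]
        exact h1 b a hb hab
    rw [dist_eq_norm, e, Real.dist_eq, mul_comm]
    refine (norm_kernelOp_apply_le hβ0 hint g).trans ?_
    gcongr
    have : ∫ s in (0 : ℝ)..1, |Real.exp (-(l * s)) - Real.exp (-(m * s))| ≤
        ∫ _ in (0 : ℝ)..1, |l - m| := by
      refine intervalIntegral.integral_mono_on zero_le_one hint.abs intervalIntegrable_const ?_
      intro s hs
      refine (hexp _ _ (mul_nonneg (le_of_lt hl) hs.1) (mul_nonneg (le_of_lt hm) hs.1)).trans ?_
      rw [← sub_mul, abs_mul, abs_of_nonneg hs.1]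
      exact mul_le_of_le_one_right (abs_nonneg _) hs.2
    simpa using this
  exact (LipschitzOnWith.of_dist_le_mul (K := ‖g‖₊) key).continuousOn

/-- A Balakrishnan integral of Laplace transforms over `[0,1]`. -/
theorem integral_rpow_smul_laplace_zero_one {E : Type*} [NormedAddCommGroup E] [NormedSpace ℝ E]
    [CompleteSpace E] {α : ℝ} (hα : 0 < α) {φ : ℝ → E}
    (hφ : IntervalIntegrable (fun s : ℝ => s ^ (-α) • φ s) volume 0 1) :
    IntegrableOn (fun l : ℝ => l ^ (α - 1) • ∫ s in (0 : ℝ)..1, Real.exp (-(l * s)) • φ s)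
        (Ioi 0) ∧
      ∫ l in Ioi (0 : ℝ), l ^ (α - 1) • ∫ s in (0 : ℝ)..1, Real.exp (-(l * s)) • φ s =
        Real.Gamma α • ∫ s in (0 : ℝ)..1, s ^ (-α) • φ s := by
  have hcut : ∀ w : ℝ → ℝ, ∫ s in Ioi (0 : ℝ), w s • (Ioc (0 : ℝ) 1).indicator φ s =
      ∫ s in (0 : ℝ)..1, w s • φ s := fun w => by
    simp only [← Set.indicator_smul_apply]
    rw [intervalIntegral.integral_of_le zero_le_one, setIntegral_indicator measurableSet_Ioc,
      inter_eq_right.2 Ioc_subset_Ioi_self]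
  have hint : IntegrableOn (fun s : ℝ => s ^ (-α) • (Ioc (0 : ℝ) 1).indicator φ s) (Ioi 0) := by
    have e : (fun s : ℝ => s ^ (-α) • (Ioc (0 : ℝ) 1).indicator φ s) =
        (Ioc (0 : ℝ) 1).indicator fun s => s ^ (-α) • φ s := by
      funext s
      by_cases hs : s ∈ Ioc (0 : ℝ) 1 <;> simp [hs]
    rw [e]
    exact ((integrable_indicator_iff measurableSet_Ioc).2
      ((intervalIntegrable_iff_integrableOn_Ioc_of_le zero_le_one).1 hφ)).integrableOn
  have := integral_rpow_smul_laplace hα hint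
  simpa only [hcut] using this

theorem hasFracPow_derivOp (hβ0 : 0 < β) {α : ℝ} (hα0 : 0 < α) (hα1 : α < 1)
    (f : (derivOp β 𝕜).domain) : HasFracPow (derivOp β 𝕜) α f := by
  refine ⟨fun l _ => ⟨_, isResolvent_derivResolvent hβ0 l⟩, ?_⟩
  simp only [resolventNeg_eq (isResolvent_derivResolvent hβ0 _)]
  set g := derivOp β 𝕜 f
  have hdom := (integral_rpow_smul_laplace_zero_one hα0 (φ := fun _ => (1 : ℝ))
    (by simpa using intervalIntegrable_rpow_neg hα1 0 1)).1.mul_const ‖g‖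
  refine Integrable.mono' hdom ?_ ?_
  · refine ContinuousOn.aestronglyMeasurable (ContinuousOn.fun_smul ?_
      (continuousOn_derivResolvent_apply hβ0 g)) measurableSet_Ioi
    exact fun l hl => (Real.continuousAt_rpow_const l _ (Or.inl (ne_of_gt hl))).continuousWithinAt
  · filter_upwards [ae_restrict_mem measurableSet_Ioi] with l hl
    have hl0 : 0 ≤ l ^ (α - 1) := Real.rpow_nonneg (le_of_lt hl) _
    rw [norm_smul, Real.norm_of_nonneg hl0, smul_eq_mul, mul_assoc]
    refine mul_le_mul_of_nonneg_left ?_ hl0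
    simpa using norm_derivResolvent_apply_le hβ0 l g

/-- The fractional derivative is the fractional integral of order `1 - α` of the derivative. -/
theorem fracDeriv_apply (hβ0 : 0 < β) {α : ℝ} (hα0 : 0 < α) (hα1 : α < 1)
    (f : (derivOp β 𝕜).domain) (x : unitInterval) :
    fracDeriv α f x = (Real.Gamma (1 - α))⁻¹ •
      ∫ s in (0 : ℝ)..1, s ^ (-α) • extend (derivOp β 𝕜 f) ((x : ℝ) - s) := by
  have hI := (hasFracPow_derivOp hβ0 hα0 hα1 f).2
  rw [← evalCLM_apply, fracDeriv, fracPow, map_smul, ← ContinuousLinearMap.integral_comp_comm _ hI]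
  simp only [resolventNeg_eq (isResolvent_derivResolvent hβ0 _), map_smul, evalCLM_apply,
    derivResolvent, kernelOp_apply]
  rw [(integral_rpow_smul_laplace_zero_one hα0 (intervalIntegrable_smul_extend hβ0
    (intervalIntegrable_rpow_neg hα1 0 1) (derivOp β 𝕜 f) x)).2, smul_smul,
    sin_div_pi_mul_Gamma hα0 hα1]

/-! ### The difference quotient as an average of the derivative -/

/-- The backward average `h⁻¹ ∫_0^h G(x - r) dr`. -/
def backwardAvg (h : ℝ) (G : ℝ → 𝕜) (x : ℝ) : 𝕜 := h⁻¹ • ∫ r in (0 : ℝ)..h, G (x - r)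

theorem norm_inv_smul_integral_le {h B : ℝ} (hh : 0 < h) {u : ℝ → 𝕜}
    (hu : ∀ r ∈ Icc 0 h, ‖u r‖ ≤ B) : ‖h⁻¹ • ∫ r in (0 : ℝ)..h, u r‖ ≤ B := by
  have h1 : ‖∫ r in (0 : ℝ)..h, u r‖ ≤ B * |h - 0| :=
    intervalIntegral.norm_integral_le_of_norm_le_const fun r hr => by
      rw [uIoc_of_le hh.le] at hr
      exact hu r (Ioc_subset_Icc_self hr)
  rw [sub_zero, abs_of_pos hh] at h1
  rw [norm_smul, norm_inv, Real.norm_of_nonneg hh.le, inv_mul_le_iff₀ hh]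
  linarith

theorem norm_backwardAvg_sub_const_le {h B x : ℝ} (hh : 0 < h) {G : ℝ → 𝕜} (hG : Continuous G)
    {w : 𝕜} (hB : ∀ r ∈ Icc 0 h, ‖G (x - r) - w‖ ≤ B) : ‖backwardAvg h G x - w‖ ≤ B := by
  have e : backwardAvg h G x - w = h⁻¹ • ∫ r in (0 : ℝ)..h, (G (x - r) - w) := by
    rw [backwardAvg, intervalIntegral.integral_sub
      (Continuous.intervalIntegrable (by fun_prop) _ _) intervalIntegrable_const,
      intervalIntegral.integral_const, smul_sub, sub_zero, smul_smul, inv_mul_cancel₀ hh.ne',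
      one_smul]
  rw [e]
  exact norm_inv_smul_integral_le hh hB

theorem norm_backwardAvg_sub_le {h K δ : ℝ} (hh : 0 < h) {G : ℝ → 𝕜} (hG : Continuous G)
    (hK : ∀ s t, |t - s| ≤ δ → ‖G t - G s‖ ≤ K * |t - s| ^ β) (s t : ℝ) (hst : |t - s| ≤ δ) :
    ‖backwardAvg h G t - backwardAvg h G s‖ ≤ K * |t - s| ^ β := by
  have e : backwardAvg h G t - backwardAvg h G s =
      h⁻¹ • ∫ r in (0 : ℝ)..h, (G (t - r) - G (s - r)) := by
    rw [backwardAvg, backwardAvg, intervalIntegral.integral_sub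
      (Continuous.intervalIntegrable (by fun_prop) _ _)
      (Continuous.intervalIntegrable (by fun_prop) _ _), smul_sub]
  rw [e]
  refine norm_inv_smul_integral_le hh fun r _ => ?_
  have := hK (s - r) (t - r)
  rw [sub_sub_sub_cancel_right] at this
  exact this hst

theorem extend_eq_integral_derivOp (hβ0 : 0 < β) (f : (derivOp β 𝕜).domain) {y : ℝ}
    (hy : y ≤ 1) : extend f.1 y = ∫ s in (0 : ℝ)..y, extend (derivOp β 𝕜 f) s := by
  have hcont := continuous_extend hβ0 (derivOp β 𝕜 f)
  rcases le_total y 0 with h | h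
  · have : ∫ s in (0 : ℝ)..y, extend (derivOp β 𝕜 f) s = 0 := by
      refine (intervalIntegral.integral_congr (g := fun _ => (0 : 𝕜)) fun s hs => ?_).trans
        intervalIntegral.integral_zero
      rw [uIcc_of_ge h] at hs
      exact extend_of_nonpos _ hs.2
    rw [this, extend_of_nonpos f.1 h]
  · rw [intervalIntegral.integral_eq_sub_of_hasDerivAt_of_le h
      ((continuousOn_extend_domain f).mono (Icc_subset_Icc_right hy))
      (fun s hs => hasDerivAt_extend_domain f ⟨hs.1, hs.2.trans_le hy⟩)
      (hcont.intervalIntegrable _ _), extend_of_nonpos f.1 le_rfl, sub_zero]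

theorem nabla_extend_eq_backwardAvg (hβ0 : 0 < β) (f : (derivOp β 𝕜).domain) {h y : ℝ}
    (hh : 0 < h) (hy : y ≤ 1) :
    nabla h (extend f.1) y = backwardAvg h (extend (derivOp β 𝕜 f)) y := by
  have hcont := continuous_extend hβ0 (derivOp β 𝕜 f)
  rw [nabla_extend, extend_eq_integral_derivOp hβ0 f hy,
    extend_eq_integral_derivOp hβ0 f (by linarith : y - h ≤ 1),
    intervalIntegral.integral_interval_sub_left (hcont.intervalIntegrable _ _)
      (hcont.intervalIntegrable _ _), backwardAvg, intervalIntegral.integral_comp_sub_left, sub_zero]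

theorem extend_extNabla (hβ0 : 0 < β) (hβ1 : β ≤ 1) {n : ℕ} {h : ℝ} (hn : 1 ≤ n) (hh : 0 < h)
    (hhn : h = 1 / n) (f : (derivOp β 𝕜).domain) {x : ℝ} (hx : x ≤ 1) :
    extend (extNabla hβ1 n f.1) x =
      linInterp h (backwardAvg h (extend (derivOp β 𝕜 f))) x := by
  have hn' : (0 : ℝ) < n := by exact_mod_cast hn
  refine extend_eq_of_le_one (g := extNabla hβ1 n f.1)
    (fun y hy => linInterp_of_nonpos hh (fun z hz => ?_) hy) (fun y => ?_) hx
  · rw [← nabla_extend_eq_backwardAvg hβ0 f hh (by linarith), nabla_extend,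
      extend_of_nonpos f.1 hz, extend_of_nonpos f.1 (by linarith), sub_zero, smul_zero]
  · rw [extNabla_apply hβ1 hn hhn]
    exact linInterp_congr hh (by rw [hhn]; field_simp)
      (fun z hz => nabla_extend_eq_backwardAvg hβ0 f hh hz) y.2.2

theorem norm_extNabla_le (hβ0 : 0 < β) (hβ1 : β ≤ 1) {n : ℕ} {h : ℝ} (hn : 1 ≤ n) (hh : 0 < h)
    (hhn : h = 1 / n) (f : (derivOp β 𝕜).domain) :
    ‖extNabla hβ1 n f.1‖ ≤ ‖derivOp β 𝕜 f‖ := by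
  have hcont := continuous_extend hβ0 (derivOp β 𝕜 f)
  have key : ∀ s t : unitInterval, (s : ℝ) ≤ t → ‖extNabla hβ1 n f.1 t - extNabla hβ1 n f.1 s‖ ≤
      ‖derivOp β 𝕜 f‖ * ((t : ℝ) - s) ^ β := fun s t hst => by
    rw [← extend_apply_coe, ← extend_apply_coe, extend_extNabla hβ0 hβ1 hn hh hhn f t.2.2,
      extend_extNabla hβ0 hβ1 hn hh hhn f s.2.2]
    exact norm_linInterp_sub_le hβ0 hβ1 hh (norm_nonneg _)
      (norm_backwardAvg_sub_le hh hcont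
        (fun a b _ => norm_extend_sub_le hβ0 (derivOp β 𝕜 f) a b)) hst le_rfl
  refine Holder.norm_le (norm_nonneg _) fun s t => ?_
  rcases le_total (s : ℝ) t with hst | hst
  · rw [abs_of_nonneg (by linarith)]; exact key s t hst
  · rw [abs_sub_comm, abs_of_nonneg (by linarith), norm_sub_rev]; exact key t s hst

/-! ### The error estimate -/

/-- Interpolation nodes next to `x`, moved back by at most `h`, are within `2h` of `x - r`. -/
theorem norm_linInterp_backwardAvg_sub_le (hβ0 : 0 < β) (hβ1 : β ≤ 1) {h K : ℝ} (hh : 0 < h)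
    (hK0 : 0 ≤ K) {G : ℝ → 𝕜} (hG : Continuous G)
    (hK : ∀ s t, |t - s| ≤ 2 * h → ‖G t - G s‖ ≤ K * |t - s| ^ β) (x : ℝ) {r : ℝ}
    (hr : r ∈ Icc 0 h) : ‖linInterp h (backwardAvg h G) x - G (x - r)‖ ≤ K * (2 * h) ^ β := by
  have hθ := ceil_sub_mem_Icc (x / h)
  set k := ⌈x / h⌉
  have h1 : x ≤ k * h := by
    have := hθ.1
    rwa [sub_nonneg, div_le_iff₀ hh] at this
  have h2 : k * h ≤ x + h := by
    have : (k : ℝ) ≤ 1 + x / h := by linarith [hθ.2]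
    calc (k : ℝ) * h ≤ (1 + x / h) * h := by gcongr
      _ = x + h := by field_simp; ring
  have hnode : ∀ z : ℝ, (∀ q ∈ Icc 0 h, |z - q - (x - r)| ≤ 2 * h) →
      ‖backwardAvg h G z - G (x - r)‖ ≤ K * (2 * h) ^ β := fun z hz =>
    norm_backwardAvg_sub_const_le hh hG fun q hq => (hK _ _ (hz q hq)).trans (by
      have := hz q hq
      gcongr)
  have := norm_convexComb_sub_le hβ0 hβ1 hK0 (by linarith : 0 ≤ 2 * h) (by linarith : 0 ≤ 2 * h) hθ
    (hnode (k * h) fun q hq => by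
      rw [abs_le]; constructor <;> linarith [hq.1, hq.2, hr.1, hr.2])
    (hnode ((k - 1) * h) fun q hq => by
      rw [abs_le]; constructor <;> linarith [hq.1, hq.2, hr.1, hr.2])
  rw [← add_mul, sub_add_cancel, one_mul] at this
  exact this

/-- The Hölder estimate of `g(· - r) - A_h f` for `0 ≤ r ≤ h`: increments over distances up to `h`
are small for both functions, and for larger distances the uniform distance of the functions is
used. -/
theorem norm_sub_linInterp_backwardAvg_sub_le (hβ0 : 0 < β) (hβ1 : β ≤ 1) {h K : ℝ} (hh : 0 < h)
    (hK0 : 0 ≤ K) {G : ℝ → 𝕜} (hG : Continuous G)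
    (hK : ∀ s t, |t - s| ≤ 2 * h → ‖G t - G s‖ ≤ K * |t - s| ^ β) {r : ℝ} (hr : r ∈ Icc 0 h)
    (x y : ℝ) :
    ‖(G (y - r) - linInterp h (backwardAvg h G) y) -
        (G (x - r) - linInterp h (backwardAvg h G) x)‖ ≤ 2 ^ (β + 1) * K * |y - x| ^ β := by
  set P := linInterp h (backwardAvg h G) with hP
  have h2 : (2 : ℝ) ^ (β + 1) = 2 * 2 ^ β := by
    rw [Real.rpow_add two_pos, Real.rpow_one, mul_comm]
  rcases le_or_gt |y - x| h with hle | hgt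
  · have hloc : ∀ x y : ℝ, x ≤ y → y - x ≤ h → ‖P y - P x‖ ≤ K * (y - x) ^ β := by
      intro x y hxy hyx
      refine norm_linInterp_sub_le (δ := 2 * h) hβ0 hβ1 hh hK0
        (norm_backwardAvg_sub_le hh hG hK) hxy ?_
      have hc : ⌈y / h⌉ ≤ ⌈x / h⌉ + 1 := Int.ceil_le.2 (by
        push_cast
        have : y / h ≤ x / h + 1 := by
          rw [div_add_one hh.ne']; gcongr; linarith
        linarith [Int.le_ceil (x / h)])
      have hc' : (⌈y / h⌉ : ℝ) ≤ ⌈x / h⌉ + 1 := by exact_mod_cast hc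
      gcongr
      linarith
    have hp : ‖P y - P x‖ ≤ K * |y - x| ^ β := by
      rcases le_total x y with hxy | hxy
      · rw [abs_of_nonneg (by linarith)] at hle ⊢; exact hloc x y hxy hle
      · rw [abs_sub_comm, abs_of_nonneg (by linarith)] at hle ⊢
        rw [norm_sub_rev]; exact hloc y x hxy hle
    have hg : ‖G (y - r) - G (x - r)‖ ≤ K * |y - x| ^ β := by
      have := hK (x - r) (y - r)
      rw [sub_sub_sub_cancel_right] at this
      exact this (by linarith)
    have h1 : (1 : ℝ) ≤ 2 ^ β := Real.one_le_rpow one_le_two hβ0.le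
    rw [sub_sub_sub_comm]
    refine (norm_sub_le _ _).trans ((add_le_add hg hp).trans ?_)
    rw [h2]
    have := mul_nonneg hK0 (Real.rpow_nonneg (abs_nonneg (y - x)) β)
    nlinarith
  · have hx := norm_linInterp_backwardAvg_sub_le hβ0 hβ1 hh hK0 hG hK x hr
    have hy := norm_linInterp_backwardAvg_sub_le hβ0 hβ1 hh hK0 hG hK y hr
    rw [norm_sub_rev] at hx hy
    refine (norm_sub_le _ _).trans ((add_le_add hy hx).trans ?_)
    calc K * (2 * h) ^ β + K * (2 * h) ^ β = 2 ^ (β + 1) * K * h ^ β := by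
          rw [h2, Real.mul_rpow two_pos.le hh.le]; ring
      _ ≤ 2 ^ (β + 1) * K * |y - x| ^ β := by gcongr

/-- The error at a point, cell by cell: the difference of the functions integrated with the
weight of the fractional integral, and the error of the weights. -/
theorem fracDeriv_sub_fracExtNabla_apply (hβ0 : 0 < β) (hβ1 : β ≤ 1) {α : ℝ} (hα0 : 0 < α)
    (hα1 : α < 1) {n : ℕ} {h : ℝ} (hn : 1 ≤ n) (hh : 0 < h) (hhn : h = 1 / n)
    (f : (derivOp β 𝕜).domain) (x : unitInterval) :
    (fracDeriv α f - fracExtNabla hβ1 α n f.1 : Holder β 𝕜) x =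
      (Real.Gamma (1 - α))⁻¹ • ∑ m ∈ Finset.range n,
        ((∫ s in (m * h : ℝ)..((m : ℝ) + 1) * h, s ^ (-α) •
          (extend (derivOp β 𝕜 f) ((x : ℝ) - s) - extend (extNabla hβ1 n f.1) ((x : ℝ) - m * h))) +
          weightError α h m • extend (extNabla hβ1 n f.1) ((x : ℝ) - m * h)) := by
  have hn' : (0 : ℝ) < n := by exact_mod_cast hn
  have hnh : n * h = 1 := by rw [hhn]; field_simp
  have hint : ∀ a b : ℝ, IntervalIntegrable
      (fun s : ℝ => s ^ (-α) • extend (derivOp β 𝕜 f) ((x : ℝ) - s)) volume a b := fun a b =>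
    intervalIntegrable_smul_extend hβ0 (intervalIntegrable_rpow_neg hα1 a b) _ _
  have hsum := intervalIntegral.sum_integral_adjacent_intervals (n := n)
    (a := fun m : ℕ => (m : ℝ) * h) fun k _ => hint (k * h) ((k + 1 : ℕ) * h)
  simp only [Nat.cast_zero, zero_mul, hnh, Nat.cast_add, Nat.cast_one] at hsum
  rw [Holder.sub_apply, fracDeriv_apply hβ0 hα0 hα1, fracExtNabla_eq hβ0 hβ1 hα0 hα1 hn hh hhn,
    Holder.smul_apply, ← smul_sub, ← hsum, ← evalCLM_apply x (∑ m ∈ Finset.range n, _), map_sum,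
    ← Finset.sum_sub_distrib]
  congr 1
  refine Finset.sum_congr rfl fun m _ => ?_
  simp only [smul_sub]
  rw [map_smul, evalCLM_apply, shift_pow_apply, intervalIntegral.integral_sub (hint _ _)
    ((intervalIntegrable_rpow_neg hα1 _ _).smul_continuousOn continuousOn_const), intervalIntegral.integral_smul_const,
    weightError, sub_smul]
  abel

/-- The main estimate. The differences `g(· - r) - A_h f` contribute the local modulus of `g = f'`
with total weight `∫_0^1 s^{-α} ds = 1/(1-α)`, and the errors of the weights contribute
`‖g‖ h^{1-α}`. -/
theorem norm_fracDeriv_sub_fracExtNabla_le (hβ0 : 0 < β) (hβ1 : β ≤ 1) {α : ℝ} (hα0 : 0 < α)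
    (hα1 : α < 1) {n : ℕ} {h : ℝ} (hn : 1 ≤ n) (hh : 0 < h) (hhn : h = 1 / n)
    (f : (derivOp β 𝕜).domain) :
    ‖fracDeriv α f - fracExtNabla hβ1 α n f.1‖ ≤
      (Real.Gamma (1 - α))⁻¹ * (1 / (1 - α) * (2 ^ (β + 1) * modulus β (derivOp β 𝕜 f) (2 * h)) +
        h ^ (1 - α) * (1 / (1 - α) + 1) * ‖derivOp β 𝕜 f‖) := by
  set g := derivOp β 𝕜 f with hg
  set K := modulus β g (2 * h) with hK
  set p := extNabla hβ1 n f.1 with hp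
  have hn' : (0 : ℝ) < n := by exact_mod_cast hn
  have hnh : n * h = 1 := by rw [hhn]; field_simp
  have hα : 0 < 1 - α := by linarith
  have hΓ : 0 < Real.Gamma (1 - α) := Real.Gamma_pos_of_pos hα
  have hK0 : 0 ≤ K := modulus_nonneg _ _
  have hcont := continuous_extend hβ0 g
  have hint : ∀ (m : ℕ) (x : unitInterval), IntervalIntegrable (fun s : ℝ => s ^ (-α) •
      (extend g ((x : ℝ) - s) - extend p ((x : ℝ) - m * h))) volume (m * h)
        (((m : ℝ) + 1) * h) := fun m x =>
    (intervalIntegrable_rpow_neg hα1 _ _).smul_continuousOn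
      (Continuous.continuousOn (by fun_prop))
  refine Holder.norm_le (by positivity) fun x y => ?_
  set d : ℝ := |(y : ℝ) - x| ^ β with hd
  have hd0 : 0 ≤ d := by positivity
  rw [fracDeriv_sub_fracExtNabla_apply hβ0 hβ1 hα0 hα1 hn hh hhn,
    fracDeriv_sub_fracExtNabla_apply hβ0 hβ1 hα0 hα1 hn hh hhn, ← smul_sub,
    ← Finset.sum_sub_distrib, norm_smul, norm_inv, Real.norm_of_nonneg hΓ.le, mul_assoc]
  refine mul_le_mul_of_nonneg_left ?_ (by positivity)
  have hcell : ∀ m ∈ Finset.range n,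
      ‖((∫ s in (m * h : ℝ)..((m : ℝ) + 1) * h, s ^ (-α) •
          (extend g ((y : ℝ) - s) - extend p ((y : ℝ) - m * h))) +
          weightError α h m • extend p ((y : ℝ) - m * h)) -
        ((∫ s in (m * h : ℝ)..((m : ℝ) + 1) * h, s ^ (-α) •
          (extend g ((x : ℝ) - s) - extend p ((x : ℝ) - m * h))) +
          weightError α h m • extend p ((x : ℝ) - m * h))‖ ≤
      (∫ s in (m * h : ℝ)..((m : ℝ) + 1) * h, s ^ (-α)) * (2 ^ (β + 1) * K * d) +
        |weightError α h m| * (‖g‖ * d) := by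
    intro m _
    have hmh : (0 : ℝ) ≤ m * h := by positivity
    have hle : (m * h : ℝ) ≤ ((m : ℝ) + 1) * h := by nlinarith
    rw [add_sub_add_comm, ← smul_sub, ← intervalIntegral.integral_sub (hint m y) (hint m x)]
    refine (norm_add_le _ _).trans (add_le_add ?_ ?_)
    · rw [← intervalIntegral.integral_mul_const]
      refine intervalIntegral.norm_integral_le_of_norm_le hle (ae_of_all _ fun s hs => ?_)
        ((intervalIntegrable_rpow_neg hα1 _ _).mul_const _)
      have hs0 : 0 ≤ s := hmh.trans hs.1.le
      rw [← smul_sub, norm_smul, Real.norm_of_nonneg (by positivity)]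
      have h1 := norm_sub_linInterp_backwardAvg_sub_le hβ0 hβ1 hh hK0 hcont
        (fun a b hab => norm_extend_sub_le_modulus hβ0 g hab) (r := s - m * h)
        ⟨by linarith [hs.1], by linarith [hs.2]⟩ ((x : ℝ) - m * h) ((y : ℝ) - m * h)
      rw [← extend_extNabla hβ0 hβ1 hn hh hhn f (x := x - m * h) (by linarith [x.2.2]),
        ← extend_extNabla hβ0 hβ1 hn hh hhn f (x := y - m * h) (by linarith [y.2.2]), sub_sub_sub_cancel_right,
        sub_sub_sub_cancel_right, sub_sub_sub_cancel_right] at h1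
      exact mul_le_mul_of_nonneg_left h1 (by positivity)
    · rw [norm_smul, Real.norm_eq_abs]
      refine mul_le_mul_of_nonneg_left ?_ (abs_nonneg _)
      have h1 := norm_extend_sub_le hβ0 p ((x : ℝ) - m * h) ((y : ℝ) - m * h)
      rw [sub_sub_sub_cancel_right] at h1
      exact h1.trans (mul_le_mul_of_nonneg_right (norm_extNabla_le hβ0 hβ1 hn hh hhn f) hd0)
  have hsum := intervalIntegral.sum_integral_adjacent_intervals (n := n)
    (a := fun m : ℕ => (m : ℝ) * h) (f := fun s : ℝ => s ^ (-α)) (μ := volume) fun k _ =>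
      intervalIntegrable_rpow_neg hα1 (k * h) ((k + 1 : ℕ) * h)
  simp only [Nat.cast_zero, zero_mul, hnh, Nat.cast_add, Nat.cast_one] at hsum
  refine (norm_sum_le _ _).trans ((Finset.sum_le_sum hcell).trans ?_)
  rw [Finset.sum_add_distrib, ← Finset.sum_mul, ← Finset.sum_mul, hsum,
    integral_rpow_neg_zero_one hα1]
  have hw := mul_le_mul_of_nonneg_right (sum_abs_weightError_le hα0 hα1 hh n)
    (mul_nonneg (norm_nonneg g) hd0)
  linarith

/-- The preceding bound is stronger: `h^{1-α} ≤ h^{1-α-β}`, and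
`1/(1-α) + 1 ≤ 2/(1-α) = 2 Γ(1-α)/Γ(2-α)`, while `errC α ≥ 0`. -/
theorem norm_fracDeriv_sub_fracExtNabla_le_errC (hβ0 : 0 < β) (hβ1 : β ≤ 1) {α : ℝ}
    (hα0 : 0 < α) (hα1 : α < 1) {n : ℕ} {h : ℝ} (hn : 1 ≤ n) (hhn : h = 1 / n)
    (f : (derivOp β 𝕜).domain) :
    ‖fracDeriv α f - fracExtNabla hβ1 α n f.1‖ ≤
      2 * (16 / Real.Gamma (2 - α) + errC α / Real.Gamma (1 - α) + 1) *
          ‖derivOp β 𝕜 f‖ * h ^ (1 - α - β) +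
        (2 ^ (β + 1) + 6) / Real.Gamma (2 - α) * modulus β (derivOp β 𝕜 f) (2 * h) := by
  have hn' : (1 : ℝ) ≤ n := by exact_mod_cast hn
  have hh : 0 < h := by rw [hhn]; positivity
  have hh1 : h ≤ 1 := by rw [hhn, div_le_one (by positivity)]; exact hn'
  have hα : 0 < 1 - α := by linarith
  have hΓ : 0 < Real.Gamma (1 - α) := Real.Gamma_pos_of_pos hα
  have hK0 : 0 ≤ modulus β (derivOp β 𝕜 f) (2 * h) := modulus_nonneg _ _
  have hC := errC_nonneg hα0 hα1
  have hpow : h ^ (1 - α) ≤ h ^ (1 - α - β) :=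
    Real.rpow_le_rpow_of_exponent_ge hh hh1 (by linarith)
  have hconst : (Real.Gamma (1 - α))⁻¹ * (1 / (1 - α) + 1) ≤
      2 * (16 / Real.Gamma (2 - α) + errC α / Real.Gamma (1 - α) + 1) := by
    have h1 : (Real.Gamma (1 - α))⁻¹ * (1 / (1 - α) + 1) ≤ 2 / Real.Gamma (2 - α) := by
      rw [Gamma_two_sub hα1]
      field_simp
      linarith
    have h2 : 0 ≤ errC α / Real.Gamma (1 - α) := by positivity
    have h3 : 2 / Real.Gamma (2 - α) ≤ 16 / Real.Gamma (2 - α) := by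
      have : 0 < Real.Gamma (2 - α) := Real.Gamma_pos_of_pos (by linarith)
      gcongr
      norm_num
    have h4 : 0 ≤ 16 / Real.Gamma (2 - α) := by
      have : 0 < Real.Gamma (2 - α) := Real.Gamma_pos_of_pos (by linarith)
      positivity
    linarith
  have hmod : (Real.Gamma (1 - α))⁻¹ * (1 / (1 - α) * 2 ^ (β + 1)) ≤
      (2 ^ (β + 1) + 6) / Real.Gamma (2 - α) := by
    rw [Gamma_two_sub hα1]
    field_simp
    linarith
  refine (norm_fracDeriv_sub_fracExtNabla_le hβ0 hβ1 hα0 hα1 hn hh hhn f).trans ?_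
  calc (Real.Gamma (1 - α))⁻¹ *
        (1 / (1 - α) * (2 ^ (β + 1) * modulus β (derivOp β 𝕜 f) (2 * h)) +
          h ^ (1 - α) * (1 / (1 - α) + 1) * ‖derivOp β 𝕜 f‖)
      = (Real.Gamma (1 - α))⁻¹ * (1 / (1 - α) + 1) * ‖derivOp β 𝕜 f‖ * h ^ (1 - α) +
        (Real.Gamma (1 - α))⁻¹ * (1 / (1 - α) * 2 ^ (β + 1)) *
          modulus β (derivOp β 𝕜 f) (2 * h) := by ring
    _ ≤ _ := by
        have h0 : 0 ≤ (Real.Gamma (1 - α))⁻¹ * (1 / (1 - α) + 1) := by positivity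
        have := h0.trans hconst
        gcongr

end FracNabla

end

open FracNabla in
theorem mainTheorem1 (𝕜 : Type*) [RCLike 𝕜] (α β : ℝ) (hα0 : 0 < α) (hα1 : α < 1)
    (hβ0 : 0 < β) (hβ1 : β < 1) (hαβ : 0 < 1 - α - β)
    (f : (derivOp β 𝕜).domain) (hf : f ∈ X β 𝕜) :
    HasFracPow (derivOp β 𝕜) α f ∧
    (∀ n : ℕ, 1 ≤ n → HasFracPow (extNablaOp (𝕜 := 𝕜) hβ1.le n) α ⟨f, Submodule.mem_top⟩) ∧
    Tendsto (fun n : ℕ => fracExtNabla hβ1.le α n (f : Holder β 𝕜)) atTop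
      (𝓝 (fracDeriv α f)) ∧
    ∀ (n : ℕ) (h : ℝ), 1 ≤ n → h = 1 / n →
      ‖fracDeriv α f - fracExtNabla hβ1.le α n (f : Holder β 𝕜)‖ ≤
        2 * (16 / Real.Gamma (2 - α) + errC α / Real.Gamma (1 - α) + 1) *
            ‖derivOp β 𝕜 f‖ * h ^ (1 - α - β) +
          (2 ^ (β + 1) + 6) / Real.Gamma (2 - α) * modulus β (derivOp β 𝕜 f) (2 * h) := by
  have hbound := fun (n : ℕ) (h : ℝ) (hn : 1 ≤ n) (hhn : h = 1 / n) =>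
    norm_fracDeriv_sub_fracExtNabla_le_errC hβ0 hβ1.le hα0 hα1 hn hhn f
  refine ⟨hasFracPow_derivOp hβ0 hα0 hα1 f,
    fun n hn => hasFracPow_extNablaOp hβ0 hβ1.le hα0 hα1 hn f.1, ?_, hbound⟩
  have hf' : Tendsto (fun δ : ℝ => modulus β (derivOp β 𝕜 f) δ) (𝓝[>] 0) (𝓝 0) := hf
  have hlim : Tendsto (fun n : ℕ => (1 : ℝ) / n) atTop (𝓝 0) := tendsto_one_div_atTop_nhds_zero_nat
  have hpow : Tendsto (fun n : ℕ => ((1 : ℝ) / n) ^ (1 - α - β)) atTop (𝓝 0) := by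
    have := hlim.rpow_const (p := 1 - α - β) (Or.inr hαβ.le)
    rwa [Real.zero_rpow hαβ.ne'] at this
  have hmod : Tendsto (fun n : ℕ => modulus β (derivOp β 𝕜 f) (2 * (1 / n))) atTop (𝓝 0) := by
    refine hf'.comp
      (tendsto_nhdsWithin_iff.2 ⟨by simpa using hlim.const_mul 2, ?_⟩)
    filter_upwards [eventually_ge_atTop 1] with n hn
    have : (0 : ℝ) < n := by exact_mod_cast hn
    exact mem_Ioi.2 (by positivity)
  rw [tendsto_iff_norm_sub_tendsto_zero]
  have hsum := (hpow.const_mul (2 * (16 / Real.Gamma (2 - α) + errC α / Real.Gamma (1 - α) + 1) *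
    ‖derivOp β 𝕜 f‖)).add (hmod.const_mul ((2 ^ (β + 1) + 6) / Real.Gamma (2 - α)))
  rw [mul_zero, mul_zero, add_zero] at hsum
  refine squeeze_zero' (Eventually.of_forall fun _ => norm_nonneg _) ?_ hsum
  filter_upwards [eventually_ge_atTop 1] with n hn
  rw [norm_sub_rev]
  exact hbound n _ hn rfl
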